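/- Let $\mathbb K\in\{\mathbb R,\mathbb C\}$, let $X$ be a Banach space over $\mathbb K$, and let $(g_n)$ denote independent standard $\mathbb K$-valued Gaussian variables. A set $\tau\subset B(X)$ is called $\gamma$-bounded with constant $K\ge 0$ if $$\Bigl(\mathbb E\Bigl\|\sum_{n=1}^m g_nT_nx_n\Bigr\|^2\Bigr)^{1/2}\le K\Bigl(\mathbb E\Bigl\|\sum_{n=1}^m g_nx_n\Bigr\|^2\Bigr)^{1/2}$$ for all $m\in\mathbb N$, all $T_1,\dots,T_m\in\tau$ (not necessarily distinct) and all $x_1,\dots,x_m\in X$. For a Hilbert space $H$ over $\mathbb K$ let $\gamma_+(H,X)$ be the space of all linear operators $u:H\to X$ with $$\|u\|_\gamma=\sup\Bigl(\mathbb E\Bigl\|\sum_{n=1}^m g_nu(e_n)\Bigr\|^2\Bigr)^{1/2}<\infty,$$ the supremum being over all finite orthonormal systems $(e_1,\dots,e_m)$ in $H$, and let $\gamma(H,X)$ be the closure of the bounded finite rank operators in $\gamma_+(H,X)$. Let $\mu$ be a $\sigma$-finite measure on $\Omega$. For a Bochner measurable $f:\Omega\to X$ with $\langle f,x'\rangle\in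 L_2(\Omega,\mu)$ for all $x'\in X'$, let $u_f\in B(L_2(\Omega,\mu),X)$ be the operator with $\langle u_fh,x'\rangle=\int_\Omega\langle f(\omega),x'\rangle h(\omega)\,d\mu(\omega)$ for all $h\in L_2(\Omega,\mu)$, $x'\in X'$. We write $f\in\gamma_+(\Omega,X)$ (respectively $f\in\gamma(\Omega,X)$) if $u_f\in\gamma_+(L_2(\Omega,\mu),X)$ (respectively $u_f\in\gamma(L_2(\Omega,\mu),X)$), and for $f\in\gamma_+(\Omega,X)$ we put $\|f\|_{\gamma(\Omega,X)}=\|u_f\|_\gamma$. **Proposition 4.11.** Let $\Omega$ be a locally compact metric space without isolated points and let $\mu$ be a $\sigma$-finite Borel measure on $\Omega$ with $\mu(U)>0$ for every nonempty open $U\subset\Omega$. Let $N:\Omega\to B(X)$ be strongly continuous, i.e. $\omega\mapsto N(\omega)x$ is continuous for every $x\in X$, and let $K\ge 0$. Then $\{N(\omega):\omega\in\Omega\}$ is $\gamma$-bounded with constant $K$ if and only if for every $f\in\gamma(\Omega,X)$ the function $N(\cdot)[f(\cdot)]$ belongs to $\gamma_+(\Omega,X)$ and $$\|N(\cdot)[f(\cdot)]\|_{\gamma(\Omega,X)}\le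 K\,\|f\|_{\gamma(\Omega,X)}.$$ -/

import Mathlib

open MeasureTheory ProbabilityTheory Filter Topology
open scoped ENNReal NNReal

noncomputable section

/-! ### Gaussian sums -/

/-- The law on `𝕜` of a standard Gaussian variable `g` with `𝔼 |g| ^ 2 = 1`.
For `𝕜 = ℝ` (where `RCLike.I = 0` and the real dimension is `1`) this is `N(0,1)`;
for `𝕜 = ℂ` it is the law of `(a + i b) / √2` with `a`, `b` independent and `N(0,1)`. -/
def stdGaussianLaw (𝕜 : Type*) [RCLike 𝕜] : Measure 𝕜 :=
  ((gaussianReal 0 ((Module.finrank ℝ 𝕜 : ℝ≥0)⁻¹)).prod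
      (gaussianReal 0 ((Module.finrank ℝ 𝕜 : ℝ≥0)⁻¹))).map
    (fun p : ℝ × ℝ => (p.1 : 𝕜) + (p.2 : 𝕜) * RCLike.I)

/-- `(𝔼 ‖∑ₙ gₙ xₙ‖ ^ 2) ^ (1/2)` for independent standard `𝕜`-valued Gaussian variables
`g₁, …, g_m`, realised as the coordinates of `𝕜 ^ m` under the product measure. -/
def gaussSumNorm (𝕜 : Type*) [RCLike 𝕜] {X : Type*} [NormedAddCommGroup X] [NormedSpace 𝕜 X]
    {m : ℕ} (x : Fin m → X) : ℝ≥0∞ :=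
  (∫⁻ g : Fin m → 𝕜, ‖∑ n, g n • x n‖ₑ ^ 2 ∂(Measure.pi fun _ => stdGaussianLaw 𝕜)) ^ (1 / 2 : ℝ)

/-- The set `τ` of bounded operators is `γ`-bounded with constant `K`. The operators
`T₁, …, T_m ∈ τ` need not be distinct. -/
def GammaBoundedWith {𝕜 : Type*} [RCLike 𝕜] {X Y : Type*} [NormedAddCommGroup X] [NormedSpace 𝕜 X]
    [NormedAddCommGroup Y] [NormedSpace 𝕜 Y] (τ : Set (X →L[𝕜] Y)) (K : ℝ≥0) : Prop :=
  ∀ (m : ℕ) (T : Fin m → X →L[𝕜] Y) (x : Fin m → X), (∀ n, T n ∈ τ) →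
    gaussSumNorm 𝕜 (fun n => T n (x n)) ≤ K * gaussSumNorm 𝕜 x

/-! ### The operator spaces `γ₊(H, X)` and `γ(H, X)` -/

section Operators

variable {𝕜 : Type*} [RCLike 𝕜] {H : Type*} [NormedAddCommGroup H] [InnerProductSpace 𝕜 H]
  {X : Type*} [NormedAddCommGroup X] [NormedSpace 𝕜 X]

/-- `‖u‖_γ ∈ [0, ∞]`, the supremum over all finite orthonormal systems `(eₙ)` in `H` of
`(𝔼 ‖∑ₙ gₙ u(eₙ)‖ ^ 2) ^ (1/2)`. -/
def gammaNorm (u : H →L[𝕜] X) : ℝ≥0∞ :=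
  ⨆ (m : ℕ) (e : Fin m → H) (_ : Orthonormal 𝕜 e), gaussSumNorm 𝕜 (fun n => u (e n))

/-- `u ∈ γ₊(H, X)`. (A linear map with finite `γ`-norm is bounded, so nothing is lost by
starting from bounded operators.) -/
def MemGammaPlus (u : H →L[𝕜] X) : Prop := gammaNorm u < ∞

/-- `u ∈ γ(H, X)`, the closure of the finite rank operators in `γ₊(H, X)`. -/
def MemGamma (u : H →L[𝕜] X) : Prop :=
  MemGammaPlus u ∧ ∀ ε : ℝ≥0∞, 0 < ε →
    ∃ v : H →L[𝕜] X, FiniteDimensional 𝕜 v.range ∧ gammaNorm (u - v) < ε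

end Operators

/-! ### The function spaces `γ₊(Ω, X)` and `γ(Ω, X)` -/

section Functions

variable (𝕜 : Type*) [RCLike 𝕜] {Ω : Type*} [MeasurableSpace Ω]
  {X : Type*} [NormedAddCommGroup X] [NormedSpace 𝕜 X]

/-- `f ∈ 𝒫₂(Ω, μ, X)`: `f` is Bochner measurable and weakly square integrable. -/
structure MemP2 (f : Ω → X) (μ : Measure Ω) : Prop where
  aestronglyMeasurable : AEStronglyMeasurable f μ
  memLp : ∀ x' : StrongDual 𝕜 X, MemLp (fun ω => x' (f ω)) 2 μ

variable {𝕜} {f : Ω → X} {μ : Measure Ω}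

/-- By the closed graph theorem, `x' ↦ ⟨f, x'⟩` is bounded from `X'` to `L₂(Ω)`. -/
def MemP2.weakMap (hf : MemP2 𝕜 f μ) : StrongDual 𝕜 X →L[𝕜] Lp 𝕜 2 μ :=
  ContinuousLinearMap.ofSeqClosedGraph
    (g := ({ toFun := fun x' => (hf.memLp x').toLp _
             map_add' := fun _ _ => rfl
             map_smul' := fun _ _ => rfl } : StrongDual 𝕜 X →ₗ[𝕜] Lp 𝕜 2 μ))
    (by
      intro u x y hu hy
      obtain ⟨ns, hns, hae⟩ := (tendstoInMeasure_of_tendsto_Lp hy).exists_seq_tendsto_ae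
      refine Lp.ext ?_
      have h1 : ∀ᵐ ω ∂μ, ∀ n, ((hf.memLp (u n)).toLp _ : Lp 𝕜 2 μ) ω = u n (f ω) :=
        ae_all_iff.2 fun n => (hf.memLp (u n)).coeFn_toLp
      filter_upwards [hae, h1, (hf.memLp x).coeFn_toLp] with ω h2 h3 h4
      refine tendsto_nhds_unique h2 ?_
      refine Tendsto.congr (f₁ := fun i => u (ns i) (f ω)) (fun i => (h3 (ns i)).symm) ?_
      change Tendsto _ _ (𝓝 (((hf.memLp x).toLp _ : Lp 𝕜 2 μ) ω))
      rw [h4]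
      exact ((ContinuousLinearMap.apply 𝕜 𝕜 (f ω)).continuous.tendsto x).comp
        (hu.comp hns.tendsto_atTop))

theorem MemP2.weakMap_ae (hf : MemP2 𝕜 f μ) (x' : StrongDual 𝕜 X) :
    hf.weakMap x' =ᵐ[μ] fun ω => x' (f ω) := (hf.memLp x').coeFn_toLp

/-- The operator `L₂(Ω) → X''` given by `h ↦ (x' ↦ ∫ ⟨f, x'⟩ h dμ)`. -/
def MemP2.bidualOp (hf : MemP2 𝕜 f μ) : Lp 𝕜 2 μ →L[𝕜] StrongDual 𝕜 (StrongDual 𝕜 X) :=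
  ((ContinuousLinearMap.compL 𝕜 (StrongDual 𝕜 X) (Lp 𝕜 2 μ) 𝕜).flip hf.weakMap) ∘L
    ((ContinuousLinearMap.mul 𝕜 𝕜).flip.lpPairing μ 2 2)

theorem MemP2.bidualOp_apply (hf : MemP2 𝕜 f μ) (h : Lp 𝕜 2 μ) (x' : StrongDual 𝕜 X) :
    hf.bidualOp h x' = ∫ ω, x' (f ω) * h ω ∂μ := by
  have : hf.bidualOp h x' =
      (ContinuousLinearMap.mul 𝕜 𝕜).flip.lpPairing μ 2 2 h (hf.weakMap x') := rfl
  rw [this, ContinuousLinearMap.lpPairing_eq_integral]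
  refine integral_congr_ae ?_
  filter_upwards [hf.weakMap_ae x'] with ω hω
  simp [hω, mul_comm]

/-- The operator of the previous definition takes values in `X`. -/
theorem MemP2.bidualOp_mem_range [CompleteSpace X] (hf : MemP2 𝕜 f μ) (h : Lp 𝕜 2 μ) :
    ∃ x : X, NormedSpace.inclusionInDoubleDual 𝕜 X x = hf.bidualOp h := by
  let _ : NormedSpace ℝ X := NormedSpace.restrictScalars ℝ 𝕜 X
  have hiso : Isometry (NormedSpace.inclusionInDoubleDual 𝕜 X) :=
    (NormedSpace.inclusionInDoubleDualLi (E := X) 𝕜).isometry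
  have hclosed : IsClosed (Set.range (NormedSpace.inclusionInDoubleDual 𝕜 X)) :=
    hiso.isClosedEmbedding.isClosed_range
  have hclosed' : IsClosed
      {h : Lp 𝕜 2 μ | ∃ x : X, NormedSpace.inclusionInDoubleDual 𝕜 X x = hf.bidualOp h} :=
    hclosed.preimage hf.bidualOp.continuous
  set f' := hf.aestronglyMeasurable.mk f with hf'
  have hsm : StronglyMeasurable f' := hf.aestronglyMeasurable.stronglyMeasurable_mk
  have hff' : f =ᵐ[μ] f' := hf.aestronglyMeasurable.ae_eq_mk
  refine Lp.induction (p := 2) (by norm_num)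
    (motive := fun h => ∃ x : X, NormedSpace.inclusionInDoubleDual 𝕜 X x = hf.bidualOp h)
    ?_ ?_ hclosed' h
  · intro c s hs hμs
    set t : ℕ → Set Ω := fun n => s ∩ {ω | ‖f' ω‖ ≤ n} with ht
    have htm : ∀ n, MeasurableSet (t n) := fun n =>
      hs.inter (measurableSet_le hsm.norm.measurable measurable_const)
    have htfin : ∀ n, μ (t n) ≠ ∞ := fun n =>
      ((measure_mono Set.inter_subset_left).trans_lt hμs).ne
    have htend : Tendsto (fun n => indicatorConstLp 2 (htm n) (htfin n) c) atTop
        (𝓝 (indicatorConstLp 2 hs hμs.ne c)) := by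
      refine tendsto_indicatorConstLp_set (by norm_num) ?_
      have h1 : ∀ n, symmDiff (t n) s = s \ t n := fun n => by
        rw [symmDiff_def]
        simp [ht, Set.sdiff_eq_empty.2 Set.inter_subset_left]
      simp only [h1]
      have h2 : (⋂ n, s \ t n) = ∅ := by
        ext ω
        simp only [Set.mem_iInter, Set.mem_empty_iff_false, iff_false, not_forall]
        obtain ⟨n, hn⟩ := exists_nat_ge ‖f' ω‖
        exact ⟨n, fun h => h.2 ⟨h.1, hn⟩⟩
      have := tendsto_measure_iInter_atTop (μ := μ) (s := fun n => s \ t n)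
        (fun n => (hs.diff (htm n)).nullMeasurableSet)
        (fun m n hmn ω hω => ⟨hω.1, fun h => hω.2 ⟨h.1,
          (show ‖f' ω‖ ≤ m from h.2).trans (by exact_mod_cast hmn)⟩⟩)
        ⟨0, ((measure_mono Set.sdiff_subset).trans_lt hμs).ne⟩
      simpa [h2, Function.comp_def] using this
    refine hclosed'.mem_of_tendsto htend (Eventually.of_forall fun n => ?_)
    have hint : IntegrableOn f (t n) μ := by
      have h3 : IntegrableOn f' (t n) μ :=
        Measure.integrableOn_of_bounded (M := n) (htfin n) hsm.aestronglyMeasurable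
          ((ae_restrict_iff' (htm n)).2 (Eventually.of_forall fun ω hω => hω.2))
      exact h3.congr (ae_restrict_of_ae hff'.symm)
    refine ⟨c • ∫ ω in t n, f ω ∂μ, ?_⟩
    ext x'
    rw [NormedSpace.dual_def, hf.bidualOp_apply, map_smul]
    have h4 : x' (∫ ω in t n, f ω ∂μ) = ∫ ω in t n, x' (f ω) ∂μ :=
      (ContinuousLinearMap.integral_comp_comm x' hint).symm
    rw [h4, smul_eq_mul, mul_comm, ← integral_mul_const, ← integral_indicator (htm n)]
    refine integral_congr_ae ?_
    filter_upwards [indicatorConstLp_coeFn (p := 2) (hs := htm n) (hμs := htfin n) (c := c)]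
      with ω hω
    rw [hω]
    by_cases hmem : ω ∈ t n <;> simp [hmem]
  · rintro a b ha hb - ⟨x, hx⟩ ⟨y, hy⟩
    exact ⟨x + y, by rw [map_add, map_add, hx, hy]⟩

/-- For `f ∈ 𝒫₂(Ω, μ, X)` there is exactly one operator `u_f ∈ B(L₂(Ω), X)` with
`⟨u_f h, x'⟩ = ∫ ⟨f, x'⟩ h dμ` for all `h` and `x'`. -/
theorem MemP2.existsUnique_op [CompleteSpace X] (hf : MemP2 𝕜 f μ) :
    ∃! u : Lp 𝕜 2 μ →L[𝕜] X, ∀ (h : Lp 𝕜 2 μ) (x' : StrongDual 𝕜 X),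
      x' (u h) = ∫ ω, x' (f ω) * h ω ∂μ := by
  choose g hg using hf.bidualOp_mem_range
  have hg' : ∀ h (x' : StrongDual 𝕜 X), x' (g h) = hf.bidualOp h x' := fun h x' => by
    rw [← hg h, NormedSpace.dual_def]
  have hinj : ∀ x y : X, (∀ x' : StrongDual 𝕜 X, x' x = x' y) → x = y := fun x y h =>
    (NormedSpace.inclusionInDoubleDualLi (E := X) 𝕜).injective
      (ContinuousLinearMap.ext fun x' => h x')
  let L : Lp 𝕜 2 μ →ₗ[𝕜] X :=
    { toFun := g
      map_add' := fun a b => hinj _ _ fun x' => by simp [hg']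
      map_smul' := fun c a => hinj _ _ fun x' => by simp [hg'] }
  have hiso : Isometry (NormedSpace.inclusionInDoubleDual 𝕜 X) :=
    (NormedSpace.inclusionInDoubleDualLi (E := X) 𝕜).isometry
  have hL : Continuous L := by
    refine hiso.isUniformInducing.isInducing.continuous_iff.2 ?_
    exact hf.bidualOp.continuous.congr fun h => (hg h).symm
  refine ⟨⟨L, hL⟩, fun h x' => ?_, fun v hv => ?_⟩
  · change x' (g h) = _
    rw [hg', hf.bidualOp_apply]
  · ext h
    refine hinj _ _ fun x' => ?_
    change _ = x' (g h)
    rw [hv, hg', hf.bidualOp_apply]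

/-- The operator `u_f : L₂(Ω) → X`, `u_f h = ∫ f h dμ` (weakly), of `f ∈ 𝒫₂(Ω, μ, X)`. -/
def MemP2.op [CompleteSpace X] (hf : MemP2 𝕜 f μ) : Lp 𝕜 2 μ →L[𝕜] X :=
  hf.existsUnique_op.choose

theorem MemP2.op_spec [CompleteSpace X] (hf : MemP2 𝕜 f μ) (h : Lp 𝕜 2 μ)
    (x' : StrongDual 𝕜 X) : x' (hf.op h) = ∫ ω, x' (f ω) * h ω ∂μ :=
  hf.existsUnique_op.choose_spec.1 h x'

variable (𝕜)

/-- `f ∈ γ₊(Ω, μ, X)`. -/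
def MemGammaPlusFun [CompleteSpace X] (f : Ω → X) (μ : Measure Ω) : Prop :=
  ∃ hf : MemP2 𝕜 f μ, MemGammaPlus hf.op

/-- `f ∈ γ(Ω, μ, X)`. -/
def MemGammaFun [CompleteSpace X] (f : Ω → X) (μ : Measure Ω) : Prop :=
  ∃ hf : MemP2 𝕜 f μ, MemGamma hf.op

open Classical in
/-- The square function norm `‖f‖_{γ(Ω, X)} = ‖u_f‖_γ` of `f ∈ γ₊(Ω, μ, X)`; it is `∞` when
`f` does not belong to `γ₊(Ω, μ, X)`. -/
def squareNorm [CompleteSpace X] (f : Ω → X) (μ : Measure Ω) : ℝ≥0∞ :=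
  if hf : MemP2 𝕜 f μ then gammaNorm hf.op else ∞

end Functions

end

/-!
The equivalence between `γ`-boundedness of `{N ω}` and boundedness of the multiplication operator
`f ↦ N f` on square functions rests on three facts.

* Covariance domination (`gaussSumNorm_matrix_le`): applying a contractive matrix to a standard
  Gaussian vector does not increase `𝔼 ‖∑ gᵢ yᵢ‖ ^ 2`. The contraction is completed to a matrix with
  orthonormal rows, which maps a standard Gaussian vector to a standard Gaussian vector
  (characteristic functions), and dropping an independent symmetric summand only decreases second
  moments. It follows (`gammaNorm_le_gaussSumNorm`) that the step function `∑ᵢ cᵢ yᵢ 𝟙_{Aᵢ}`, where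
  the `cᵢ 𝟙_{Aᵢ}` are orthonormal in `L₂`, has square function norm at most
  `(𝔼 ‖∑ gᵢ yᵢ‖ ^ 2) ^ (1/2)`.
* A Fatou lemma (`MemP2.of_tendsto_ae`): a bound on the `γ`-norms of a sequence of functions passes
  to its almost everywhere limit, membership in `𝒫₂` included. Boundedness in `L₂` and almost
  everywhere convergence give weak convergence of the associated operators, along which Gaussian
  second moments are lower semicontinuous.
* Localisation (`MemP2.norm_op_indicatorConstLp_sub_le`): if `f` is close to a constant on `A`, then
  `u_f` maps the normalised indicator of `A` close to the correspondingly scaled constant.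

If multiplication by `N` is bounded, one tests it on step functions supported near finitely many
points `ωₙ`. Without isolated points these may be moved slightly to become distinct, so that
disjoint supports are available; by strong continuity and localisation the values of `u_{N f}` on
the normalised indicators approach `N(ωₙ) xₙ`.

If conversely `{N ω}` is `γ`-bounded and `f` has finite `γ`-norm, then `Ω` is partitioned into
countably many pieces on which both `f` and `N f` oscillate little. Replacing `f` by its mean value
and `N` by its value at a sample point on each of finitely many pieces gives a step function with
`γ`-norm at most `K ‖f‖_γ`, because the mean values are images under `u_f` of an orthogonal system.
The Fatou lemma is used twice, to pass to all pieces and then to let the oscillation tend to zero.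
This direction uses of `f` only that it belongs to `γ₊(Ω, X)`. Measurability of `N f` comes from
strong continuity together with second countability of `Ω`, which is forced by the measure.
-/

open MeasureTheory ProbabilityTheory Filter Topology
open scoped ENNReal NNReal

noncomputable section

/-! ### The standard Gaussian law on `𝕜 ^ m` -/

section GaussianLaw

open ComplexConjugate

variable {𝕜 : Type*} [RCLike 𝕜]

/-- The real-linear map `(a, b) ↦ a + b i` under which `stdGaussianLaw 𝕜` is the image of a
product of two real Gaussian laws. -/
def reImCLM (𝕜 : Type*) [RCLike 𝕜] : ℝ × ℝ →L[ℝ] 𝕜 :=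
  (RCLike.ofRealCLM : ℝ →L[ℝ] 𝕜).coprod
    ((ContinuousLinearMap.mul ℝ 𝕜).flip RCLike.I ∘L (RCLike.ofRealCLM : ℝ →L[ℝ] 𝕜))

theorem reImCLM_apply (p : ℝ × ℝ) :
    reImCLM 𝕜 p = (p.1 : 𝕜) + (p.2 : 𝕜) * RCLike.I := by
  simp [reImCLM, mul_comm]

theorem stdGaussianLaw_eq_map :
    stdGaussianLaw 𝕜 = ((gaussianReal 0 ((Module.finrank ℝ 𝕜 : ℝ≥0)⁻¹)).prod
      (gaussianReal 0 ((Module.finrank ℝ 𝕜 : ℝ≥0)⁻¹))).map (reImCLM 𝕜) := by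
  unfold stdGaussianLaw
  exact congrArg (Measure.map · _) (funext fun p => (reImCLM_apply p).symm)

instance isGaussian_stdGaussianLaw : IsGaussian (stdGaussianLaw 𝕜) := by
  rw [stdGaussianLaw_eq_map]
  infer_instance

theorem charFunDual_gaussianReal_zero (v : ℝ≥0) (L : StrongDual ℝ ℝ) :
    charFunDual (gaussianReal 0 v) L = Complex.exp (-((v * L 1 ^ 2 / 2 : ℝ) : ℂ)) := by
  have h : L = InnerProductSpace.toDualMap ℝ ℝ (L 1) := by
    ext
    simp
  conv_lhs => rw [h]
  rw [← charFun_eq_charFunDual_toDualMap, charFun_gaussianReal]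
  congr 1
  push_cast
  ring

/-- Real-linear functionals on `𝕜` are of the form `z ↦ re (conj t * z)`; for `𝕜 = ℝ` the
`I`-component of `t` vanishes. -/
theorem exists_eq_re_conj_mul (L : StrongDual ℝ 𝕜) :
    ∃ t : 𝕜, ∀ z, L z = RCLike.re (conj t * z) := by
  refine ⟨(L 1 : 𝕜) + (L RCLike.I : 𝕜) * RCLike.I, fun z => ?_⟩
  have hz : z = (RCLike.re z) • (1 : 𝕜) + (RCLike.im z) • (RCLike.I : 𝕜) := by
    conv_lhs => rw [← RCLike.re_add_im z]
    simp [RCLike.real_smul_eq_coe_mul]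
  conv_lhs => rw [hz]
  rcases RCLike.I_mul_I_ax (K := 𝕜) with h | h
  · simp [h, RCLike.mul_re]
    ring
  · have hI := RCLike.I_im z
    simp [RCLike.mul_re]
    linear_combination (-(L RCLike.I)) * hI

theorem charFunDual_stdGaussianLaw {L : StrongDual ℝ 𝕜} {t : 𝕜}
    (h : ∀ z, L z = RCLike.re (conj t * z)) :
    charFunDual (stdGaussianLaw 𝕜) L =
      Complex.exp (-(((Module.finrank ℝ 𝕜 : ℝ)⁻¹ * ‖t‖ ^ 2 / 2 : ℝ) : ℂ)) := by
  rw [stdGaussianLaw_eq_map, charFunDual_map, charFunDual_prod, charFunDual_gaussianReal_zero,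
    charFunDual_gaussianReal_zero, ← Complex.exp_add]
  congr 1
  have h1 : L 1 = RCLike.re t := by simp [h]
  have h2 : L RCLike.I = RCLike.im t := by
    simp [h, RCLike.mul_re]
  have h3 : ‖t‖ ^ 2 = L 1 ^ 2 + L RCLike.I ^ 2 := by
    rw [h1, h2, ← RCLike.normSq_eq_def', RCLike.normSq_apply]
    ring
  rw [h3]
  simp only [ContinuousLinearMap.comp_apply, ContinuousLinearMap.inl_apply,
    ContinuousLinearMap.inr_apply, reImCLM_apply]
  push_cast
  simp
  ring

theorem charFunDual_pi_stdGaussianLaw {ι : Type*} [Fintype ι] {L : StrongDual ℝ (ι → 𝕜)}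
    {t : ι → 𝕜} (h : ∀ g, L g = RCLike.re (∑ n, conj (t n) * g n)) :
    charFunDual (Measure.pi fun _ : ι => stdGaussianLaw 𝕜) L =
      Complex.exp (-(((Module.finrank ℝ 𝕜 : ℝ)⁻¹ * (∑ n, ‖t n‖ ^ 2) / 2 : ℝ) : ℂ)) := by
  classical
  rw [charFunDual_pi]
  rw [Finset.prod_congr rfl fun n _ => charFunDual_stdGaussianLaw (t := t n) fun z => ?_]
  · rw [← Complex.exp_sum, Finset.mul_sum, Finset.sum_div]
    simp
  · simp [h, Pi.single_apply]

theorem exists_eq_re_sum_conj_mul {ι : Type*} [Fintype ι] (L : StrongDual ℝ (ι → 𝕜)) :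
    ∃ t : ι → 𝕜, ∀ g, L g = RCLike.re (∑ n, conj (t n) * g n) := by
  classical
  choose t ht using fun n =>
    exists_eq_re_conj_mul (L ∘L ContinuousLinearMap.single ℝ (fun _ => 𝕜) n)
  refine ⟨t, fun g => ?_⟩
  rw [map_sum]
  simp_rw [← ht]
  rw [ContinuousLinearMap.sum_comp_single]

end GaussianLaw

/-! ### Gaussian sums and covariance domination -/

section GaussSum

open ComplexConjugate

variable {𝕜 : Type*} [RCLike 𝕜] {X : Type*} [NormedAddCommGroup X] [NormedSpace 𝕜 X]

/-- If the rows of the block matrix `(B C)` are orthonormal, then `B g + C g'` is a standard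
Gaussian vector whenever `g` and `g'` are independent standard Gaussian vectors. -/
theorem map_prod_pi_stdGaussianLaw {ι κ κ' : Type*} [Fintype ι] [Fintype κ] [Fintype κ']
    (B : ι → κ → 𝕜) (C : ι → κ' → 𝕜)
    (h : ∀ t : ι → 𝕜, ∑ j, ‖∑ i, conj (B i j) * t i‖ ^ 2 + ∑ l, ‖∑ i, conj (C i l) * t i‖ ^ 2 =
      ∑ i, ‖t i‖ ^ 2) :
    ((Measure.pi fun _ : κ => stdGaussianLaw 𝕜).prod
        (Measure.pi fun _ : κ' => stdGaussianLaw 𝕜)).map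
      (fun p i => ∑ j, B i j * p.1 j + ∑ l, C i l * p.2 l) =
    Measure.pi fun _ : ι => stdGaussianLaw 𝕜 := by
  let T : (κ → 𝕜) × (κ' → 𝕜) →L[𝕜] (ι → 𝕜) :=
    ContinuousLinearMap.pi fun i =>
      (∑ j, B i j • ContinuousLinearMap.proj (φ := fun _ : κ => 𝕜) j).coprod
        (∑ l, C i l • ContinuousLinearMap.proj (φ := fun _ : κ' => 𝕜) l)
  have hT : (fun (p : (κ → 𝕜) × (κ' → 𝕜)) i => ∑ j, B i j * p.1 j + ∑ l, C i l * p.2 l) =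
      T.restrictScalars ℝ := by
    funext p i
    simp [T]
  rw [hT]
  have : IsFiniteMeasure (((Measure.pi fun _ : κ => stdGaussianLaw 𝕜).prod
      (Measure.pi fun _ : κ' => stdGaussianLaw 𝕜)).map (T.restrictScalars ℝ)) :=
    Measure.isFiniteMeasure_map _ _
  refine Measure.ext_of_charFunDual (funext fun L => ?_)
  obtain ⟨t, ht⟩ := exists_eq_re_sum_conj_mul L
  rw [charFunDual_map, charFunDual_prod, charFunDual_pi_stdGaussianLaw ht,
    charFunDual_pi_stdGaussianLaw (t := fun j => ∑ i, conj (B i j) * t i),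
    charFunDual_pi_stdGaussianLaw (t := fun l => ∑ i, conj (C i l) * t i), ← Complex.exp_add,
    ← h t]
  · congr 1
    push_cast
    ring
  · intro g
    have h1 : L ((T.restrictScalars ℝ) (0, g)) = _ := ht _
    refine h1.trans (congrArg _ ?_)
    rw [← hT]
    simp only [Finset.mul_sum, Finset.sum_mul, map_sum, map_mul, RCLike.conj_conj, Pi.zero_apply,
      mul_zero, Finset.sum_const_zero, zero_add]
    rw [Finset.sum_comm]
    refine Finset.sum_congr rfl fun l _ => Finset.sum_congr rfl fun i _ => ?_
    ring
  · intro g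
    have h1 : L ((T.restrictScalars ℝ) (g, 0)) = _ := ht _
    refine h1.trans (congrArg _ ?_)
    rw [← hT]
    simp only [Finset.mul_sum, Finset.sum_mul, map_sum, map_mul, RCLike.conj_conj, Pi.zero_apply,
      mul_zero, Finset.sum_const_zero, add_zero]
    rw [Finset.sum_comm]
    refine Finset.sum_congr rfl fun l _ => Finset.sum_congr rfl fun i _ => ?_
    ring

theorem map_neg_pi_stdGaussianLaw {ι : Type*} [Fintype ι] :
    (Measure.pi fun _ : ι => stdGaussianLaw 𝕜).map (fun g => -g) =
      Measure.pi fun _ : ι => stdGaussianLaw 𝕜 := by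
  have hT : (fun g : ι → 𝕜 => -g) = (-ContinuousLinearMap.id ℝ (ι → 𝕜) : _ →L[ℝ] _) := by
    ext; simp
  rw [hT]
  have : IsFiniteMeasure ((Measure.pi fun _ : ι => stdGaussianLaw 𝕜).map
      (-ContinuousLinearMap.id ℝ (ι → 𝕜) : _ →L[ℝ] _)) :=
    Measure.isFiniteMeasure_map _ _
  refine Measure.ext_of_charFunDual (funext fun L => ?_)
  obtain ⟨t, ht⟩ := exists_eq_re_sum_conj_mul L
  rw [charFunDual_map, charFunDual_pi_stdGaussianLaw ht,
    charFunDual_pi_stdGaussianLaw (t := fun n => -t n)]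
  · simp
  · intro g
    have h1 : L (-g) = _ := ht _
    simpa using h1

theorem continuous_gaussSum {ι : Type*} [Fintype ι] (x : ι → X) :
    Continuous fun g : ι → 𝕜 => ∑ n, g n • x n := by fun_prop

/-- Adding an independent symmetric Gaussian sum does not decrease second moments. -/
theorem enorm_sq_le_lintegral_add {ι : Type*} [Fintype ι] (y : X) (z : ι → X) :
    ‖y‖ₑ ^ 2 ≤ ∫⁻ g : ι → 𝕜, ‖y + ∑ n, g n • z n‖ₑ ^ 2
      ∂(Measure.pi fun _ => stdGaussianLaw 𝕜) := by
  have hpar : ∀ z : X, 2 * ‖y‖ₑ ^ 2 ≤ ‖y + z‖ₑ ^ 2 + ‖y + -z‖ₑ ^ 2 := by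
    intro z
    have h1 : 2 * ‖y‖ ≤ ‖y + z‖ + ‖y + -z‖ := by
      have h2 : ‖(2 : 𝕜) • y‖ ≤ ‖y + z‖ + ‖y + -z‖ := by
        have h3 : (2 : 𝕜) • y = (y + z) + (y + -z) := by rw [two_smul]; abel
        rw [h3]
        exact norm_add_le _ _
      simpa [norm_smul] using h2
    have h : 2 * ‖y‖ ^ 2 ≤ ‖y + z‖ ^ 2 + ‖y + -z‖ ^ 2 := by
      nlinarith [norm_nonneg y, sq_nonneg (‖y + z‖ - ‖y + -z‖)]
    have h' : 2 * ‖y‖₊ ^ 2 ≤ ‖y + z‖₊ ^ 2 + ‖y + -z‖₊ ^ 2 := by exact_mod_cast h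
    simp only [enorm_eq_nnnorm]
    exact_mod_cast h'
  set ν := Measure.pi fun _ : ι => stdGaussianLaw 𝕜 with hν
  have hm : ∀ y' : X, Measurable fun g : ι → 𝕜 => ‖y' + ∑ n, g n • z n‖ₑ ^ 2 := fun y' =>
    (continuous_enorm.comp (continuous_const.add (continuous_gaussSum z))).measurable.pow_const 2
  have hneg : ∫⁻ g : ι → 𝕜, ‖y + -∑ n, g n • z n‖ₑ ^ 2 ∂ν =
      ∫⁻ g : ι → 𝕜, ‖y + ∑ n, g n • z n‖ₑ ^ 2 ∂ν := by
    conv_rhs => rw [hν, ← map_neg_pi_stdGaussianLaw]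
    rw [lintegral_map (hm y) measurable_neg]
    simp [hν]
  have h2 : 2 * ‖y‖ₑ ^ 2 ≤ 2 * ∫⁻ g : ι → 𝕜, ‖y + ∑ n, g n • z n‖ₑ ^ 2 ∂ν := by
    calc 2 * ‖y‖ₑ ^ 2 = ∫⁻ _ : ι → 𝕜, 2 * ‖y‖ₑ ^ 2 ∂ν := by simp [ν]
      _ ≤ ∫⁻ g : ι → 𝕜, (‖y + ∑ n, g n • z n‖ₑ ^ 2 + ‖y + -∑ n, g n • z n‖ₑ ^ 2) ∂ν :=
        lintegral_mono fun g => hpar _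
      _ = _ := by rw [lintegral_add_left (hm y), hneg, two_mul]
  exact (ENNReal.mul_le_mul_iff_right (by norm_num) (by norm_num)).1 h2

/-- Covariance domination: passing from `∑ gᵢ yᵢ` to the Gaussian sum of `∑ᵢ Bᵢⱼ yᵢ`, where the
matrix `B` is completed by `C` to one with orthonormal rows, does not increase second moments. -/
theorem gaussSumNorm_matrix_le {m k : ℕ} {κ' : Type*} [Fintype κ'] (y : Fin m → X)
    (B : Fin m → Fin k → 𝕜) (C : Fin m → κ' → 𝕜)
    (h : ∀ t : Fin m → 𝕜, ∑ j, ‖∑ i, conj (B i j) * t i‖ ^ 2 +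
      ∑ l, ‖∑ i, conj (C i l) * t i‖ ^ 2 = ∑ i, ‖t i‖ ^ 2) :
    gaussSumNorm 𝕜 (fun j => ∑ i, B i j • y i) ≤ gaussSumNorm 𝕜 y := by
  unfold gaussSumNorm
  refine ENNReal.rpow_le_rpow ?_ (by norm_num)
  rw [← map_prod_pi_stdGaussianLaw B C h, lintegral_map]
  rotate_left
  · exact (continuous_enorm.comp (continuous_gaussSum y)).measurable.pow_const 2
  · fun_prop
  rw [lintegral_prod]
  rotate_left
  · refine ((continuous_enorm.comp ((continuous_gaussSum y).comp ?_)).measurable.pow_const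
      2).aemeasurable
    fun_prop
  refine lintegral_mono fun g => ?_
  refine (enorm_sq_le_lintegral_add (𝕜 := 𝕜) _ (fun l => ∑ i, C i l • y i)).trans_eq ?_
  refine lintegral_congr fun g' => ?_
  congr 2
  simp only [add_smul, Finset.sum_add_distrib, Finset.smul_sum, Finset.sum_smul, smul_smul]
  congr 1
  all_goals
    rw [Finset.sum_comm]
    refine Finset.sum_congr rfl fun i _ => Finset.sum_congr rfl fun j _ => ?_
    rw [mul_comm]

theorem gaussSumNorm_eq_eLpNorm {m : ℕ} (x : Fin m → X) :
    gaussSumNorm 𝕜 x = eLpNorm (fun g : Fin m → 𝕜 => ∑ n, g n • x n) 2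
      (Measure.pi fun _ => stdGaussianLaw 𝕜) := by
  rw [eLpNorm_eq_lintegral_rpow_enorm_toReal (by norm_num) (by norm_num)]
  simp [gaussSumNorm]

theorem gaussSumNorm_lt_top {m : ℕ} (x : Fin m → X) : gaussSumNorm 𝕜 x < ∞ := by
  rw [gaussSumNorm_eq_eLpNorm]
  refine (memLp_finsetSum _ fun n _ => ?_).2
  have h1 : MemLp (fun g : Fin m → 𝕜 => g n) 2 (Measure.pi fun _ => stdGaussianLaw 𝕜) :=
    (IsGaussian.memLp_two_id (μ := stdGaussianLaw 𝕜)).comp_measurePreserving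
      (measurePreserving_eval (fun _ : Fin m => stdGaussianLaw 𝕜) n)
  exact ((ContinuousLinearMap.id 𝕜 𝕜).smulRight (x n)).comp_memLp' h1

/-- The constant `(𝔼 |g| ^ 2) ^ (1/2)` is left unevaluated: only its finiteness and positivity
matter. -/
theorem gaussSumNorm_single (x : X) :
    gaussSumNorm 𝕜 (fun _ : Fin 1 => x) = gaussSumNorm 𝕜 (fun _ : Fin 1 => (1 : 𝕜)) * ‖x‖ₑ := by
  unfold gaussSumNorm
  simp only [Finset.univ_unique, Finset.sum_singleton, enorm_smul, mul_pow, enorm_one, mul_one]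
  rw [lintegral_mul_const' _ _ (by finiteness), ENNReal.mul_rpow_of_nonneg _ _ (by norm_num)]
  congr 1
  rw [← ENNReal.rpow_natCast, ← ENNReal.rpow_mul]
  simp

/-- A standard Gaussian variable is not almost surely zero. -/
theorem gaussSumNorm_one_ne_zero : gaussSumNorm 𝕜 (fun _ : Fin 1 => (1 : 𝕜)) ≠ 0 := by
  rw [gaussSumNorm_eq_eLpNorm, Ne, eLpNorm_eq_zero_iff
    (continuous_gaussSum _).aestronglyMeasurable (by norm_num)]
  intro h
  have h1 : ∀ᵐ z : 𝕜 ∂(stdGaussianLaw 𝕜), z = 0 := by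
    rw [← (measurePreserving_eval (fun _ : Fin 1 => stdGaussianLaw 𝕜) 0).map_eq]
    refine (ae_map_iff (f := fun g : Fin 1 → 𝕜 => g 0) (p := fun z => z = 0)
      (measurable_pi_apply 0).aemeasurable (measurableSet_singleton 0)).2 ?_
    filter_upwards [h] with g hg
    simpa using hg
  rw [stdGaussianLaw_eq_map, ae_map_iff (p := (· = 0))
    (reImCLM 𝕜).continuous.measurable.aemeasurable
    (measurableSet_singleton 0)] at h1
  set v : ℝ≥0 := (Module.finrank ℝ 𝕜 : ℝ≥0)⁻¹ with hv
  have hv0 : v ≠ 0 := inv_ne_zero (Nat.cast_ne_zero.2 Module.finrank_pos.ne')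
  have h2 : ∀ᵐ a : ℝ ∂(gaussianReal 0 v), a = 0 := by
    rw [← (measurePreserving_fst (μ := gaussianReal 0 v) (ν := gaussianReal 0 v)).map_eq,
      ae_map_iff (p := (· = 0)) measurable_fst.aemeasurable (measurableSet_singleton 0)]
    filter_upwards [h1] with p hp
    have := congrArg RCLike.re hp
    rw [reImCLM_apply] at this
    simpa [RCLike.mul_re] using this
  have := nullSingletonClass_gaussianReal (μ := 0) hv0
  have h3 : ∀ᵐ a : ℝ ∂(gaussianReal 0 v), a ≠ 0 := by
    simp [ae_iff]
  obtain ⟨a, ha, ha'⟩ := (h2.and h3).exists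
  exact ha' ha

/-- Second moments of Gaussian sums are lower semicontinuous along weakly convergent
coefficients. -/
theorem gaussSumNorm_le_of_tendsto_weak {m : ℕ} {x : ℕ → Fin m → X} {y : Fin m → X} {C : ℝ≥0∞}
    (hC : ∀ j, gaussSumNorm 𝕜 (x j) ≤ C)
    (h : ∀ n (x' : StrongDual 𝕜 X), Tendsto (fun j => x' (x j n)) atTop (𝓝 (x' (y n)))) :
    gaussSumNorm 𝕜 y ≤ C := by
  have key : ∀ g : Fin m → 𝕜, ‖∑ n, g n • y n‖ₑ ^ 2 ≤
      liminf (fun j => ‖∑ n, g n • x j n‖ₑ ^ 2) atTop := by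
    intro g
    obtain ⟨x', hx', hxy⟩ := exists_dual_vector'' 𝕜 (∑ n, g n • y n)
    -- The norm is weakly lower semicontinuous: a norming functional sees the limit.
    have hlim : Tendsto (fun j => ‖x' (∑ n, g n • x j n)‖ₑ ^ 2) atTop
        (𝓝 (‖x' (∑ n, g n • y n)‖ₑ ^ 2)) := by
      refine (ENNReal.continuous_pow 2).tendsto _ |>.comp
        ((continuous_enorm.tendsto _).comp ?_)
      simp only [map_sum, map_smul]
      exact tendsto_finsetSum _ fun n _ => (h n x').const_smul _
    have h1 : ‖x' (∑ n, g n • y n)‖ₑ = ‖∑ n, g n • y n‖ₑ := by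
      rw [hxy]
      simp [enorm_eq_nnnorm]
    rw [← h1, ← hlim.liminf_eq]
    refine liminf_le_liminf (Eventually.of_forall fun j => ?_)
    simp only [enorm_eq_nnnorm]
    norm_cast
    gcongr
    have := x'.le_of_opNorm_le hx' (∑ n, g n • x j n)
    rw [one_mul] at this
    exact_mod_cast this
  rw [gaussSumNorm, one_div, ENNReal.rpow_inv_le_iff (by norm_num)]
  refine (lintegral_mono key).trans ((lintegral_liminf_le fun j =>
    (continuous_enorm.comp (continuous_gaussSum (x j))).measurable.pow_const 2).trans ?_)
  refine liminf_le_of_le (by isBoundedDefault) fun b hb => ?_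
  obtain ⟨j, hj⟩ := hb.exists
  refine hj.trans ?_
  have := hC j
  rwa [gaussSumNorm, one_div, ENNReal.rpow_inv_le_iff (by norm_num)] at this

end GaussSum

/-! ### Operators and their `γ`-norms -/

section GammaNorm

open ComplexConjugate

variable {𝕜 : Type*} [RCLike 𝕜] {H : Type*} [NormedAddCommGroup H] [InnerProductSpace 𝕜 H]
  {X : Type*} [NormedAddCommGroup X] [NormedSpace 𝕜 X]

theorem gaussSumNorm_le_gammaNorm {m : ℕ} (u : H →L[𝕜] X) {e : Fin m → H}
    (he : Orthonormal 𝕜 e) : gaussSumNorm 𝕜 (fun n => u (e n)) ≤ gammaNorm u :=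
  le_iSup_of_le m (le_iSup_of_le e (le_iSup_of_le he le_rfl))

/-- Bessel's inequality with an explicit defect: relative to finitely many vectors `aᵢ`, an
orthonormal system `e` is completed by further vectors `b` to one satisfying Parseval's identity on
the span of the `aᵢ`. -/
theorem exists_parseval_completion {m k : ℕ} {e : Fin k → H} (he : Orthonormal 𝕜 e)
    (a : Fin m → H) :
    ∃ (d : ℕ) (b : Fin d → H), ∀ t : Fin m → 𝕜,
      ∑ j, ‖inner 𝕜 (e j) (∑ i, t i • a i)‖ ^ 2 + ∑ l, ‖inner 𝕜 (b l) (∑ i, t i • a i)‖ ^ 2 =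
        ‖∑ i, t i • a i‖ ^ 2 := by
  let P : H →ₗ[𝕜] H := ∑ j, (innerₛₗ 𝕜 (e j)).smulRight (e j)
  have hP : ∀ v, P v = ∑ j, inner 𝕜 (e j) v • e j := fun v => by simp [P]
  have horth : ∀ v j, inner 𝕜 (e j) (v - P v) = 0 := by
    intro v j
    rw [inner_sub_right, hP, he.inner_right_fintype, sub_self]
  have hspan : ∀ v w, inner 𝕜 (P w) (v - P v) = 0 := by
    intro v w
    rw [hP w, sum_inner]
    refine Finset.sum_eq_zero fun j _ => ?_
    rw [inner_smul_left, horth, mul_zero]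
  let S : Submodule 𝕜 H := Submodule.span 𝕜 (Set.range fun i => a i - P (a i))
  have : FiniteDimensional 𝕜 S := FiniteDimensional.span_of_finite 𝕜 (Set.finite_range _)
  let b := stdOrthonormalBasis 𝕜 S
  have hS : ∀ w ∈ S, ∀ v, inner 𝕜 w (P v) = 0 := by
    intro w hw v
    induction hw using Submodule.span_induction with
    | mem x hx =>
      obtain ⟨i, rfl⟩ := hx
      rw [← inner_conj_symm, hspan, map_zero]
    | zero => simp
    | add x y _ _ hx hy => rw [inner_add_left, hx, hy, add_zero]
    | smul c x _ hx => rw [inner_smul_left, hx, mul_zero]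
  refine ⟨_, fun l => (b l : H), fun t => ?_⟩
  set v := ∑ i, t i • a i with hv
  have hvS : v - P v ∈ S := by
    rw [hv, map_sum, ← Finset.sum_sub_distrib]
    refine S.sum_mem fun i _ => ?_
    rw [map_smul, ← smul_sub]
    exact S.smul_mem _ (Submodule.subset_span ⟨i, rfl⟩)
  have h1 : ∑ j, ‖inner 𝕜 (e j) v‖ ^ 2 = ‖P v‖ ^ 2 := by
    rw [← RCLike.ofReal_inj (K := 𝕜)]
    push_cast
    rw [← inner_self_eq_norm_sq_to_K (P v)]
    conv_rhs => rw [hP v]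
    rw [he.inner_sum]
    exact Finset.sum_congr rfl fun j _ => (RCLike.conj_mul _).symm
  have h2 : ∑ l, ‖inner 𝕜 (b l : H) v‖ ^ 2 = ‖v - P v‖ ^ 2 := by
    have := b.sum_sq_norm_inner_right ⟨v - P v, hvS⟩
    rw [Submodule.coe_norm] at this
    rw [← this]
    refine Finset.sum_congr rfl fun l _ => ?_
    rw [Submodule.coe_inner, inner_sub_right, hS _ (b l).2, sub_zero]
  have h3 : ‖v‖ ^ 2 = ‖P v‖ ^ 2 + ‖v - P v‖ ^ 2 := by
    have := norm_add_sq_eq_norm_sq_add_norm_sq_of_inner_eq_zero (P v) (v - P v) (hspan v v)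
    rw [add_sub_cancel] at this
    nlinarith [this]
  rw [h1, h2, h3]

/-- A finite rank operator written along an orthonormal system has `γ`-norm at most the Gaussian
norm of its values. -/
theorem gammaNorm_le_gaussSumNorm {m : ℕ} {a : Fin m → H} (ha : Orthonormal 𝕜 a) (y : Fin m → X)
    {u : H →L[𝕜] X} (hu : ∀ h, u h = ∑ i, inner 𝕜 (a i) h • y i) :
    gammaNorm u ≤ gaussSumNorm 𝕜 y := by
  refine iSup_le fun k => iSup_le fun e => iSup_le fun he => ?_
  obtain ⟨d, b, hb⟩ := exists_parseval_completion he a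
  simp only [hu]
  refine gaussSumNorm_matrix_le y (fun i j => inner 𝕜 (a i) (e j))
    (fun i l => inner 𝕜 (a i) (b l)) fun t => ?_
  have h1 : ∀ v, ∑ i, conj (inner 𝕜 (a i) v) * t i = inner 𝕜 v (∑ i, t i • a i) := by
    intro v
    simp [inner_sum, inner_smul_right, inner_conj_symm, mul_comm]
  simp only [h1]
  rw [hb t, ← RCLike.ofReal_inj (K := 𝕜)]
  push_cast
  rw [← inner_self_eq_norm_sq_to_K, ha.inner_sum]
  exact Finset.sum_congr rfl fun j _ => RCLike.conj_mul _

theorem enorm_apply_le_gammaNorm (u : H →L[𝕜] X) (h : H) :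
    gaussSumNorm 𝕜 (fun _ : Fin 1 => (1 : 𝕜)) * ‖u h‖ₑ ≤ gammaNorm u * ‖h‖ₑ := by
  rcases eq_or_ne h 0 with rfl | hh
  · simp
  set e : H := ((‖h‖⁻¹ : ℝ) : 𝕜) • h with he
  have hne : ‖e‖ = 1 := by
    simp [he, norm_smul, norm_ne_zero_iff.2 hh]
  have ho : Orthonormal 𝕜 (fun _ : Fin 1 => e) :=
    ⟨fun _ => hne, fun i j hij => (hij (Subsingleton.elim _ _)).elim⟩
  have h1 := gaussSumNorm_le_gammaNorm u ho
  rw [gaussSumNorm_single] at h1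
  have h2 : h = (‖h‖ : 𝕜) • e := by
    rw [he, smul_smul, ← RCLike.ofReal_mul, mul_inv_cancel₀ (norm_ne_zero_iff.2 hh)]
    simp
  have h3 : ‖u h‖ₑ = ‖u e‖ₑ * ‖h‖ₑ := by
    conv_lhs => rw [h2, map_smul, enorm_smul]
    rw [mul_comm]
    simp [enorm_eq_nnnorm]
  rw [h3, ← mul_assoc]
  gcongr

end GammaNorm

/-! ### The operators associated with functions -/

section WeakConvergence

variable {𝕜 : Type*} [RCLike 𝕜] {Ω : Type*} [MeasurableSpace Ω] {μ : Measure Ω}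

theorem eLpNorm_indicator_mul_le {a h : Ω → 𝕜} (ha : AEStronglyMeasurable a μ)
    (hh : AEStronglyMeasurable h μ) {s : Set Ω} (hs : MeasurableSet s) :
    eLpNorm (s.indicator (a * h)) 1 μ ≤ eLpNorm a 2 μ * eLpNorm (s.indicator h) 2 μ := by
  have : s.indicator (a * h) = a • s.indicator h := by
    rw [smul_eq_mul]
    ext ω
    by_cases hmem : ω ∈ s <;> simp [hmem]
  rw [this]
  exact eLpNorm_smul_le_mul_eLpNorm (hh.indicator hs) ha

/-- A sequence that is bounded in `L₂` and converges almost everywhere converges weakly in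
`L₂`. -/
theorem tendsto_integral_mul_of_tendsto_ae {a : ℕ → Ω → 𝕜} {b h : Ω → 𝕜} {R : ℝ≥0}
    (ha : ∀ n, AEStronglyMeasurable (a n) μ) (hR : ∀ n, eLpNorm (a n) 2 μ ≤ R)
    (hlim : ∀ᵐ ω ∂μ, Tendsto (fun n => a n ω) atTop (𝓝 (b ω))) (hh : MemLp h 2 μ) :
    Tendsto (fun n => ∫ ω, a n ω * h ω ∂μ) atTop (𝓝 (∫ ω, b ω * h ω ∂μ)) := by
  have hb : MemLp b 2 μ := by
    refine ⟨aestronglyMeasurable_of_tendsto_ae atTop ha hlim, ?_⟩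
    refine (Lp.eLpNorm_lim_le_liminf_eLpNorm ha b hlim).trans_lt ?_
    refine lt_of_le_of_lt (liminf_le_of_le (a := (R : ℝ≥0∞)) (by isBoundedDefault)
      fun c hc => ?_) ENNReal.coe_lt_top
    obtain ⟨n, hn⟩ := hc.exists
    exact hn.trans (hR n)
  have hint : ∀ {g : Ω → 𝕜}, MemLp g 2 μ → MemLp (g * h) 1 μ := fun hg => hh.mul hg
  have hε : ∀ ε : ℝ≥0∞, (R : ℝ≥0∞) * (ε / (R + 1)) ≤ ε := fun ε => by
    calc (R : ℝ≥0∞) * (ε / (R + 1)) ≤ (R + 1) * (ε / (R + 1)) := by gcongr; exact le_self_add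
      _ ≤ ε := ENNReal.mul_div_le
  have hui : UnifIntegrable (fun n => a n * h) 1 μ := by
    intro ε hε0
    have hpos : 0 < ε / ((R : ℝ) + 1) := by positivity
    obtain ⟨δ, hδ, H⟩ := hh.eLpNorm_indicator_le (by norm_num) (by norm_num) hpos
    refine ⟨δ, hδ, fun n s hs hμs => (eLpNorm_indicator_mul_le (ha n) hh.1 hs).trans ?_⟩
    refine (mul_le_mul' (hR n) (H s hs hμs)).trans ?_
    refine le_of_eq_of_le ?_ (hε _)
    rw [ENNReal.ofReal_div_of_pos (by positivity), ENNReal.ofReal_add (by positivity) (by norm_num)]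
    simp
  have hut : UnifTight (fun n => a n * h) 1 μ := by
    intro ε hε0
    have hpos : (ε : ℝ≥0∞) / (R + 1) ≠ 0 :=
      (ENNReal.div_pos (by exact_mod_cast hε0.ne') (by finiteness)).ne'
    obtain ⟨s, hs, hμs, H⟩ := hh.exists_eLpNorm_indicator_compl_lt (by norm_num) hpos
    exact ⟨s, hμs.ne, fun n => (eLpNorm_indicator_mul_le (ha n) hh.1 hs.compl).trans
      ((mul_le_mul' (hR n) H.le).trans (hε _))⟩
  have hconv := tendsto_Lp_of_tendsto_ae le_rfl (by norm_num)
    (fun n => (ha n).mul hh.1) (hint hb) hui hut (by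
      filter_upwards [hlim] with ω hω
      exact hω.mul_const (h ω))
  refine tendsto_integral_of_L1' (b * h) (memLp_one_iff_integrable.1 (hint hb)).1
    (Eventually.of_forall fun n => memLp_one_iff_integrable.1 (hint ⟨ha n, ?_⟩)) hconv
  exact (hR n).trans_lt ENNReal.coe_lt_top

end WeakConvergence

section Op

variable {𝕜 : Type*} [RCLike 𝕜] {Ω : Type*} [MeasurableSpace Ω] {μ : Measure Ω}
  {X : Type*} [NormedAddCommGroup X] [NormedSpace 𝕜 X]

theorem eq_of_forall_strongDual_eq (𝕜 : Type*) [RCLike 𝕜] [NormedSpace 𝕜 X] {x y : X}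
    (h : ∀ x' : StrongDual 𝕜 X, x' x = x' y) : x = y :=
  (NormedSpace.inclusionInDoubleDualLi (E := X) 𝕜).injective
    (ContinuousLinearMap.ext fun x' => h x')

theorem MemP2.congr {f g : Ω → X} (hf : MemP2 𝕜 f μ) (hfg : f =ᵐ[μ] g) : MemP2 𝕜 g μ :=
  ⟨hf.1.congr hfg, fun x' => (memLp_congr_ae (hfg.fun_comp x')).1 (hf.2 x')⟩

variable [CompleteSpace X]

theorem MemP2.op_eq {f : Ω → X} (hf : MemP2 𝕜 f μ) {h : Lp 𝕜 2 μ} {x : X}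
    (hx : ∀ x' : StrongDual 𝕜 X, ∫ ω, x' (f ω) * h ω ∂μ = x' x) : hf.op h = x :=
  eq_of_forall_strongDual_eq 𝕜 fun x' => by rw [hf.op_spec, hx]

theorem MemP2.op_congr {f g : Ω → X} (hf : MemP2 𝕜 f μ) (hg : MemP2 𝕜 g μ) (hfg : f =ᵐ[μ] g) :
    hf.op = hg.op := by
  ext h
  refine hf.op_eq fun x' => ?_
  rw [hg.op_spec]
  refine integral_congr_ae ?_
  filter_upwards [hfg] with ω hω
  rw [hω]

/-- The weak `L₂` norm of `f` is controlled by the operator `u_f`, hence by its `γ`-norm. -/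
theorem MemP2.eLpNorm_le {f : Ω → X} (hf : MemP2 𝕜 f μ) (x' : StrongDual 𝕜 X) :
    gaussSumNorm 𝕜 (fun _ : Fin 1 => (1 : 𝕜)) * eLpNorm (fun ω => x' (f ω)) 2 μ ≤
      gammaNorm hf.op * ‖x'‖ₑ := by
  set c := gaussSumNorm 𝕜 (fun _ : Fin 1 => (1 : 𝕜))
  -- `u_f` is tested on the conjugate of `⟨f, x'⟩`, for which the pairing is the squared norm.
  set h : Lp 𝕜 2 μ := star ((hf.memLp x').toLp _) with hh
  have hae : h =ᵐ[μ] fun ω => star (x' (f ω)) := by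
    filter_upwards [Lp.coeFn_star ((hf.memLp x').toLp _), (hf.memLp x').coeFn_toLp] with ω h1 h2
    rw [hh, h1, Pi.star_apply, h2]
  have hnorm : ‖h‖ₑ = eLpNorm (fun ω => x' (f ω)) 2 μ := by
    rw [Lp.enorm_def, eLpNorm_congr_ae hae]
    exact eLpNorm_congr_norm_ae (Eventually.of_forall fun ω => by simp)
  have hfin : ‖h‖ₑ ≠ ∞ := by finiteness
  have h1 : x' (hf.op h) = ((‖h‖ ^ 2 : ℝ) : 𝕜) := by
    rw [hf.op_spec]
    have := L2.inner_def (𝕜 := 𝕜) h h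
    rw [inner_self_eq_norm_sq_to_K] at this
    push_cast
    rw [this]
    refine integral_congr_ae ?_
    filter_upwards [hae] with ω hω
    simp [hω, RCLike.mul_conj]
  have h2 : ‖h‖ₑ * ‖h‖ₑ ≤ ‖x'‖ₑ * ‖hf.op h‖ₑ := by
    have h3 : ‖h‖ₑ * ‖h‖ₑ = ‖x' (hf.op h)‖ₑ := by
      rw [h1]
      simp [enorm_eq_nnnorm, pow_two]
    rw [h3]
    exact x'.le_opENorm _
  rw [← hnorm]
  rcases eq_or_ne ‖h‖ₑ 0 with h0 | h0
  · simp [h0]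
  refine (ENNReal.mul_le_mul_iff_left h0 hfin).1 ?_
  calc c * ‖h‖ₑ * ‖h‖ₑ = c * (‖h‖ₑ * ‖h‖ₑ) := mul_assoc _ _ _
    _ ≤ c * (‖x'‖ₑ * ‖hf.op h‖ₑ) := by gcongr
    _ = ‖x'‖ₑ * (c * ‖hf.op h‖ₑ) := by ring
    _ ≤ ‖x'‖ₑ * (gammaNorm hf.op * ‖h‖ₑ) :=
      mul_le_mul_right (enorm_apply_le_gammaNorm _ _) _
    _ = _ := by ring

/-- The `γ`-Fatou lemma: `γ`-norm bounds pass to almost everywhere limits. -/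
theorem MemP2.of_tendsto_ae {f : ℕ → Ω → X} {g : Ω → X} {C : ℝ≥0∞} (hC : C ≠ ∞)
    (hf : ∀ n, MemP2 𝕜 (f n) μ) (hfC : ∀ n, gammaNorm (hf n).op ≤ C)
    (hlim : ∀ᵐ ω ∂μ, Tendsto (fun n => f n ω) atTop (𝓝 (g ω))) :
    ∃ hg : MemP2 𝕜 g μ, gammaNorm hg.op ≤ C := by
  set c := gaussSumNorm 𝕜 (fun _ : Fin 1 => (1 : 𝕜)) with hc
  have hc0 : c ≠ 0 := gaussSumNorm_one_ne_zero
  have hct : c ≠ ∞ := (gaussSumNorm_lt_top _).ne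
  have hbound : ∀ x' : StrongDual 𝕜 X, ∃ R : ℝ≥0, ∀ n,
      eLpNorm (fun ω => x' (f n ω)) 2 μ ≤ R := by
    intro x'
    have hfin : C * ‖x'‖ₑ / c ≠ ∞ := ENNReal.div_ne_top (by finiteness) hc0
    refine ⟨(C * ‖x'‖ₑ / c).toNNReal, fun n => ?_⟩
    rw [ENNReal.coe_toNNReal hfin, ENNReal.le_div_iff_mul_le (Or.inl hc0) (Or.inl hct), mul_comm]
    refine ((hf n).eLpNorm_le x').trans ?_
    gcongr
    exact hfC n
  have hlim' : ∀ x' : StrongDual 𝕜 X,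
      ∀ᵐ ω ∂μ, Tendsto (fun n => x' (f n ω)) atTop (𝓝 (x' (g ω))) := fun x' => by
    filter_upwards [hlim] with ω hω
    exact (x'.continuous.tendsto _).comp hω
  have hg : MemP2 𝕜 g μ := by
    refine ⟨aestronglyMeasurable_of_tendsto_ae atTop (fun n => (hf n).1) hlim, fun x' => ?_⟩
    obtain ⟨R, hR⟩ := hbound x'
    refine ⟨aestronglyMeasurable_of_tendsto_ae atTop (fun n => ((hf n).2 x').1) (hlim' x'), ?_⟩
    refine (Lp.eLpNorm_lim_le_liminf_eLpNorm (fun n => ((hf n).2 x').1) _ (hlim' x')).trans_lt ?_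
    refine lt_of_le_of_lt (liminf_le_of_le (a := (R : ℝ≥0∞)) (by isBoundedDefault)
      fun c hc => ?_) ENNReal.coe_lt_top
    obtain ⟨n, hn⟩ := hc.exists
    exact hn.trans (hR n)
  refine ⟨hg, iSup_le fun m => iSup_le fun e => iSup_le fun he => ?_⟩
  refine gaussSumNorm_le_of_tendsto_weak (x := fun j n => (hf j).op (e n))
    (fun j => (gaussSumNorm_le_gammaNorm _ he).trans (hfC j)) fun n x' => ?_
  obtain ⟨R, hR⟩ := hbound x'
  simp only [MemP2.op_spec]
  exact tendsto_integral_mul_of_tendsto_ae (fun j => ((hf j).2 x').1) hR (hlim' x') (Lp.memLp _)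

end Op

section Indicators

variable {𝕜 : Type*} [RCLike 𝕜] {Ω : Type*} [MeasurableSpace Ω] {μ : Measure Ω}
  {X : Type*} [NormedAddCommGroup X] [NormedSpace 𝕜 X]

theorem orthonormal_indicatorConstLp {ι : Type*} {A : ι → Set Ω} (hA : ∀ i, MeasurableSet (A i))
    (hfin : ∀ i, μ (A i) ≠ ∞) (hdis : Pairwise (Function.onFun Disjoint A)) {c : ι → ℝ}
    (hc : ∀ i, c i ^ 2 * μ.real (A i) = 1) :
    Orthonormal 𝕜 fun i => indicatorConstLp 2 (hA i) (hfin i) (c i : 𝕜) := by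
  classical
  rw [orthonormal_iff_ite]
  intro i j
  rw [L2.inner_indicatorConstLp_indicatorConstLp (hA i) (hA j) (hfin i) (hfin j)]
  split_ifs with hij
  · subst hij
    have := hc i
    rw [Set.inter_self]
    simp only [RCLike.inner_apply, RCLike.conj_ofReal, RCLike.real_smul_eq_coe_mul]
    norm_cast
    linarith
  · rw [(hdis hij).inter_eq]
    simp

variable [CompleteSpace X]

/-- If `f` is close to a constant on `A`, then the operator `u_f` maps the normalised indicator of
`A` close to the correspondingly normalised constant. -/
theorem MemP2.norm_op_indicatorConstLp_sub_le {f : Ω → X} (hf : MemP2 𝕜 f μ) {A : Set Ω}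
    (hA : MeasurableSet A) (hfin : μ A ≠ ∞) {c ε : ℝ} (hc0 : 0 ≤ c)
    (hc : c ^ 2 * μ.real A = 1) {y : X}
    (hy : ∀ ω ∈ A, ‖f ω - (c : 𝕜) • y‖ ≤ c * ε) :
    ‖hf.op (indicatorConstLp 2 hA hfin (c : 𝕜)) - y‖ ≤ ε := by
  have : IsFiniteMeasure (μ.restrict A) := ⟨by simpa using hfin.lt_top⟩
  have hcpos : 0 < c := lt_of_le_of_ne hc0 (by rintro rfl; simp at hc)
  have hne : A.Nonempty := by
    rw [Set.nonempty_iff_ne_empty]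
    rintro rfl
    simp at hc
  have hε : 0 ≤ ε := by
    obtain ⟨ω, hω⟩ := hne
    exact (mul_nonneg_iff_of_pos_left hcpos).1 ((norm_nonneg _).trans (hy ω hω))
  refine NormedSpace.norm_le_dual_bound 𝕜 _ hε fun x' => ?_
  have hint : IntegrableOn (fun ω => x' (f ω)) A μ :=
    ((hf.memLp x').restrict A).integrable (by norm_num)
  have hcK : (c : 𝕜) * ((μ.real A : 𝕜) * c) = 1 := by
    norm_cast
    linarith
  have h1 : x' (hf.op (indicatorConstLp 2 hA hfin (c : 𝕜)) - y) =
      c * ∫ ω in A, x' (f ω - (c : 𝕜) • y) ∂μ := by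
    simp only [map_sub, map_smul]
    rw [integral_sub hint (integrable_const _), setIntegral_const, hf.op_spec, mul_sub,
      RCLike.real_smul_eq_coe_mul, smul_eq_mul, ← mul_assoc (μ.real A : 𝕜), ← mul_assoc (c : 𝕜),
      hcK, one_mul, ← integral_const_mul, ← integral_indicator hA]
    congr 1
    refine integral_congr_ae ?_
    filter_upwards [indicatorConstLp_coeFn (p := 2) (hs := hA) (hμs := hfin) (c := (c : 𝕜))]
      with ω hω
    rw [hω]
    by_cases hmem : ω ∈ A <;> simp [hmem, mul_comm]
  rw [h1, norm_mul, RCLike.norm_ofReal, abs_of_pos hcpos]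
  have h2 : ‖∫ ω in A, x' (f ω - (c : 𝕜) • y) ∂μ‖ ≤ ‖x'‖ * (c * ε) * μ.real A :=
    norm_setIntegral_le_of_norm_le_const hfin.lt_top fun ω hω =>
      (x'.le_opNorm _).trans (by gcongr; exact hy ω hω)
  calc c * ‖∫ ω in A, x' (f ω - (c : 𝕜) • y) ∂μ‖ ≤ c * (‖x'‖ * (c * ε) * μ.real A) := by gcongr
    _ = (c ^ 2 * μ.real A) * (ε * ‖x'‖) := by ring
    _ = _ := by rw [hc, one_mul]

/-- The operator of a step function `∑ᵢ cᵢ yᵢ 𝟙_{Aᵢ}` is `h ↦ ∑ᵢ ⟨cᵢ 𝟙_{Aᵢ}, h⟩ yᵢ`. -/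
theorem exists_op_sum_indicator {ι : Type*} [Fintype ι] {A : ι → Set Ω}
    (hA : ∀ i, MeasurableSet (A i)) (hfin : ∀ i, μ (A i) ≠ ∞) (c : ι → ℝ) (y : ι → X) :
    ∃ hf : MemP2 𝕜 (fun ω => ∑ i, (A i).indicator (fun _ => (c i : 𝕜) • y i) ω) μ,
      ∀ h, hf.op h = ∑ i, inner 𝕜 (indicatorConstLp 2 (hA i) (hfin i) (c i : 𝕜)) h • y i := by
  have hx' : ∀ (x' : StrongDual 𝕜 X) ω, x' (∑ i, (A i).indicator (fun _ => (c i : 𝕜) • y i) ω) =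
      ∑ i, (A i).indicator (fun _ => (c i : 𝕜) * x' (y i)) ω := by
    intro x' ω
    rw [map_sum]
    refine Finset.sum_congr rfl fun i _ => ?_
    by_cases hmem : ω ∈ A i <;> simp [hmem]
  have hf : MemP2 𝕜 (fun ω => ∑ i, (A i).indicator (fun _ => (c i : 𝕜) • y i) ω) μ := by
    refine ⟨Finset.aestronglyMeasurable_fun_sum _ fun i _ =>
      aestronglyMeasurable_const.indicator (hA i), fun x' => ?_⟩
    simp only [hx']
    exact memLp_finsetSum _ fun i _ => memLp_indicator_const 2 (hA i) _ (Or.inr (hfin i))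
  refine ⟨hf, fun h => hf.op_eq fun x' => ?_⟩
  have hint : ∀ i, IntegrableOn h (A i) μ := fun i =>
    have : IsFiniteMeasure (μ.restrict (A i)) := ⟨by simpa using (hfin i).lt_top⟩
    ((Lp.memLp h).restrict (A i)).integrable (by norm_num)
  have hpt : ∀ ω, x' (∑ i, (A i).indicator (fun _ => (c i : 𝕜) • y i) ω) * h ω =
      ∑ i, (A i).indicator (fun ω => (c i : 𝕜) * x' (y i) * h ω) ω := by
    intro ω
    rw [hx', Finset.sum_mul]
    refine Finset.sum_congr rfl fun i _ => ?_
    by_cases hmem : ω ∈ A i <;> simp [hmem]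
  simp only [hpt]
  rw [integral_finsetSum _ fun i _ =>
    IntegrableOn.integrable_indicator ((hint i).const_mul _) (hA i), map_sum]
  refine Finset.sum_congr rfl fun i _ => ?_
  rw [integral_indicator (hA i), map_smul, L2.inner_indicatorConstLp_eq_setIntegral_inner]
  simp only [RCLike.inner_apply, RCLike.conj_ofReal, smul_eq_mul]
  rw [integral_const_mul, integral_mul_const]
  ring

theorem exists_gammaNorm_op_sum_indicator_le {m : ℕ} {A : Fin m → Set Ω}
    (hA : ∀ i, MeasurableSet (A i)) (hfin : ∀ i, μ (A i) ≠ ∞)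
    (hdis : Pairwise (Function.onFun Disjoint A)) {c : Fin m → ℝ}
    (hc : ∀ i, c i ^ 2 * μ.real (A i) = 1) (y : Fin m → X) :
    ∃ hf : MemP2 𝕜 (fun ω => ∑ i, (A i).indicator (fun _ => (c i : 𝕜) • y i) ω) μ,
      gammaNorm hf.op ≤ gaussSumNorm 𝕜 y ∧ FiniteDimensional 𝕜 hf.op.range := by
  obtain ⟨hf, hop⟩ := exists_op_sum_indicator (𝕜 := 𝕜) hA hfin c y
  refine ⟨hf, gammaNorm_le_gaussSumNorm (orthonormal_indicatorConstLp hA hfin hdis hc) y hop, ?_⟩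
  have : FiniteDimensional 𝕜 (Submodule.span 𝕜 (Set.range y)) :=
    FiniteDimensional.span_of_finite 𝕜 (Set.finite_range _)
  refine Submodule.finiteDimensional_of_le (S₂ := Submodule.span 𝕜 (Set.range y)) ?_
  rintro _ ⟨h, rfl⟩
  change hf.op h ∈ _
  rw [hop]
  exact Submodule.sum_mem _ fun i _ => Submodule.smul_mem _ _ (Submodule.subset_span ⟨i, rfl⟩)

end Indicators

/-! ### Necessity of `γ`-boundedness -/

section Necessity

theorem exists_pairwise_disjoint_isOpen_subset {Ω ι : Type*} [TopologicalSpace Ω] [T2Space Ω]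
    [PerfectSpace Ω] [Fintype ι] {U : ι → Set Ω} (hU : ∀ i, IsOpen (U i))
    (hne : ∀ i, (U i).Nonempty) :
    ∃ V : ι → Set Ω, (∀ i, IsOpen (V i) ∧ (V i).Nonempty ∧ V i ⊆ U i) ∧
      Pairwise (Function.onFun Disjoint V) := by
  classical
  have hinf : ∀ i, (U i).Infinite := fun i => by
    obtain ⟨ω, hω⟩ := hne i
    exact infinite_of_mem_nhds ω ((hU i).mem_nhds hω)
  choose t ht hcard using fun i => (hinf i).exists_subset_card_eq (Fintype.card ι)
  -- Each candidate set has as many points as there are indices, so Hall's condition is immediate.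
  obtain ⟨p, hp, hpt⟩ := (Finset.all_card_le_biUnion_card_iff_exists_injective t).1 fun s => by
    rcases s.eq_empty_or_nonempty with rfl | ⟨i, hi⟩
    · simp
    · calc s.card ≤ Fintype.card ι := s.card_le_univ
        _ = (t i).card := (hcard i).symm
        _ ≤ _ := Finset.card_le_card (Finset.subset_biUnion_of_mem t hi)
  obtain ⟨W, hW, hdis⟩ := (Set.finite_range p).t2_separation
  refine ⟨fun i => W (p i) ∩ U i, fun i => ⟨(hW _).2.inter (hU i), ⟨p i, (hW _).1, ht i (hpt i)⟩,
    Set.inter_subset_right⟩, fun i j hij => ?_⟩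
  exact (hdis ⟨i, rfl⟩ ⟨j, rfl⟩ (hp.ne hij)).mono Set.inter_subset_left Set.inter_subset_left

/-- The normalising constant that turns the indicator of `A` into a unit vector of `L₂`. -/
theorem exists_sq_mul_measureReal_eq_one {Ω : Type*} [MeasurableSpace Ω] {μ : Measure Ω}
    {A : Set Ω} (h0 : μ A ≠ 0) (hfin : μ A ≠ ∞) : ∃ c : ℝ, 0 ≤ c ∧ c ^ 2 * μ.real A = 1 := by
  refine ⟨(√(μ.real A))⁻¹, by positivity, ?_⟩
  rw [inv_pow, Real.sq_sqrt measureReal_nonneg]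
  exact inv_mul_cancel₀ ((measureReal_ne_zero_iff hfin).2 h0)

variable {𝕜 : Type*} [RCLike 𝕜] {X : Type*} [NormedAddCommGroup X] [NormedSpace 𝕜 X]

theorem memGamma_of_finiteDimensional {H : Type*} [NormedAddCommGroup H] [InnerProductSpace 𝕜 H]
    {u : H →L[𝕜] X} (hu : gammaNorm u < ∞) (hrange : FiniteDimensional 𝕜 u.range) : MemGamma u :=
  ⟨hu, fun ε hε => ⟨u, hrange, by simpa [gammaNorm, gaussSumNorm] using hε⟩⟩

/-- A multiplier bound on square functions forces `γ`-boundedness: test it on step functions that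
concentrate near finitely many distinct points. -/
theorem gammaBoundedWith_range_of_squareNorm_le {Ω : Type*} [TopologicalSpace Ω] [T2Space Ω]
    [PerfectSpace Ω] [MeasurableSpace Ω] [BorelSpace Ω] {μ : Measure Ω} [SigmaFinite μ]
    [μ.IsOpenPosMeasure] [CompleteSpace X] {N : Ω → X →L[𝕜] X}
    (hN : ∀ x : X, Continuous fun ω => N ω x) {K : ℝ≥0}
    (h : ∀ f : Ω → X, MemGammaFun 𝕜 f μ → MemGammaPlusFun 𝕜 (fun ω => N ω (f ω)) μ ∧
      squareNorm 𝕜 (fun ω => N ω (f ω)) μ ≤ K * squareNorm 𝕜 f μ) :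
    GammaBoundedWith (Set.range N) K := by
  intro m T x hT
  choose p hp using hT
  have key : ∀ ε : ℝ, 0 < ε → ∃ y : Fin m → X, (∀ n, ‖y n - T n (x n)‖ ≤ ε) ∧
      gaussSumNorm 𝕜 y ≤ K * gaussSumNorm 𝕜 x := by
    intro ε hε
    -- The points behind the `T n` need not be distinct, but nearby disjoint open sets exist.
    obtain ⟨V, hV, hVdis⟩ := exists_pairwise_disjoint_isOpen_subset
      (U := fun n => {ω | ‖N ω (x n) - T n (x n)‖ < ε})
      (fun n => isOpen_lt ((hN (x n)).sub continuous_const).norm continuous_const)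
      (fun n => ⟨p n, by simpa [hp] using hε⟩)
    choose A hA hAV hApos hAfin using fun n => Measure.exists_subset_measure_lt_top
      (μ := μ) (hV n).1.measurableSet ((hV n).1.measure_pos μ (hV n).2.1)
    choose c hc0 hc using fun n => exists_sq_mul_measureReal_eq_one (hApos n).ne' (hAfin n).ne
    have hAdis : Pairwise (Function.onFun Disjoint A) := fun i j hij =>
      (hVdis hij).mono (hAV i) (hAV j)
    obtain ⟨hf, hle, hrange⟩ := exists_gammaNorm_op_sum_indicator_le (𝕜 := 𝕜) hA
      (fun n => (hAfin n).ne) hAdis hc x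
    set f : Ω → X := fun ω => ∑ i, (A i).indicator (fun _ => (c i : 𝕜) • x i) ω with hfdef
    obtain ⟨⟨hNf, -⟩, hNle⟩ := h f
      ⟨hf, memGamma_of_finiteDimensional (hle.trans_lt (gaussSumNorm_lt_top x)) hrange⟩
    rw [squareNorm, squareNorm, dif_pos hf, dif_pos hNf] at hNle
    refine ⟨fun n => hNf.op (indicatorConstLp 2 (hA n) (hAfin n).ne (c n : 𝕜)), fun n => ?_, ?_⟩
    · refine hNf.norm_op_indicatorConstLp_sub_le (hA n) (hAfin n).ne (hc0 n) (hc n) fun ω hω => ?_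
      have hfω : f ω = (c n : 𝕜) • x n := by
        rw [hfdef]
        refine (Finset.sum_eq_single n (fun j _ hj => ?_) (by simp)).trans
          (Set.indicator_of_mem hω _)
        exact Set.indicator_of_notMem (fun hωj => (hAdis hj).le_bot ⟨hωj, hω⟩) _
      rw [hfω, map_smul, ← smul_sub, norm_smul, RCLike.norm_ofReal, abs_of_nonneg (hc0 n)]
      exact mul_le_mul_of_nonneg_left ((hV n).2.2 (hAV n hω)).le (hc0 n)
    · refine (gaussSumNorm_le_gammaNorm _ (orthonormal_indicatorConstLp hA
        (fun n => (hAfin n).ne) hAdis hc)).trans (hNle.trans ?_)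
      gcongr
  choose y hy hyle using fun j : ℕ => key (1 / ((j : ℝ) + 1)) (by positivity)
  refine gaussSumNorm_le_of_tendsto_weak hyle fun n x' => (x'.continuous.tendsto _).comp ?_
  rw [tendsto_iff_norm_sub_tendsto_zero]
  exact squeeze_zero (fun _ => norm_nonneg _) (fun j => hy j n)
    tendsto_one_div_add_atTop_nhds_zero_nat

end Necessity

/-! ### Sufficiency of `γ`-boundedness -/

section Measurability

/-- A metric space carrying an s-finite measure that charges all nonempty open sets is second
countable: disjoint balls around an `ε`-separated set all have positive measure, so there are only
countably many of them. -/
theorem secondCountableTopology_of_isOpenPosMeasure {Ω : Type*} [PseudoMetricSpace Ω]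
    [MeasurableSpace Ω] [OpensMeasurableSpace Ω] (μ : Measure Ω) [SFinite μ]
    [μ.IsOpenPosMeasure] : SecondCountableTopology Ω := by
  refine Metric.secondCountable_of_almost_dense_set fun ε hε => ?_
  obtain ⟨S, hS⟩ := zorn_subset {s : Set Ω | s.Pairwise fun x y => ε ≤ dist x y}
    fun c hc hchain => ⟨⋃₀ c, (Set.pairwise_sUnion hchain.directedOn).2 fun s hs => hc hs,
      fun s hs => Set.subset_sUnion_of_mem hs⟩
  refine ⟨S, ?_, fun x => ?_⟩
  · have hdis : Pairwise (Function.onFun Disjoint fun x : S => Metric.ball (x : Ω) (ε / 2)) := by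
      intro x y hxy
      refine Metric.ball_disjoint_ball ?_
      rw [add_halves]
      exact hS.prop x.2 y.2 (Subtype.coe_injective.ne hxy)
    have hcount := Measure.countable_meas_pos_of_disjoint_iUnion (μ := μ)
      (fun x : S => Metric.isOpen_ball.measurableSet) hdis
    have huniv : {x : S | 0 < μ (Metric.ball (x : Ω) (ε / 2))} = Set.univ :=
      Set.eq_univ_of_forall fun x => Metric.measure_ball_pos μ _ (by positivity)
    rw [huniv, Set.countable_univ_iff] at hcount
    exact Set.countable_coe_iff.1 hcount
  · by_contra! hx
    have hins : insert x S ∈ {s : Set Ω | s.Pairwise fun x y => ε ≤ dist x y} :=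
      Set.pairwise_insert.2
        ⟨hS.prop, fun y hy _ => ⟨(hx y hy).le, (dist_comm x y) ▸ (hx y hy).le⟩⟩
    have hmem : x ∈ S := hS.le_of_ge hins (Set.subset_insert x S) (Set.mem_insert x S)
    have := hx x hmem
    rw [dist_self] at this
    exact this.not_ge hε.le

theorem stronglyMeasurable_clm_apply {𝕜 : Type*} [NontriviallyNormedField 𝕜] {Ω : Type*}
    [TopologicalSpace Ω] [SecondCountableTopology Ω] [MeasurableSpace Ω] [OpensMeasurableSpace Ω]
    {X Y : Type*} [NormedAddCommGroup X] [NormedSpace 𝕜 X] [NormedAddCommGroup Y] [NormedSpace 𝕜 Y]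
    {N : Ω → X →L[𝕜] Y} (hN : ∀ x : X, Continuous fun ω => N ω x) {f : Ω → X}
    (hf : StronglyMeasurable f) : StronglyMeasurable fun ω => N ω (f ω) := by
  refine stronglyMeasurable_of_tendsto (f := fun n ω => N ω (hf.approx n ω)) atTop (fun n => ?_)
    (tendsto_pi_nhds.2 fun ω => ((N ω).continuous.tendsto _).comp (hf.tendsto_approx ω))
  set s := hf.approx n
  have hsum : (fun ω => N ω (s ω)) =
      fun ω => ∑ x ∈ s.range, (s ⁻¹' {x}).indicator (fun ω => N ω x) ω := by
    funext ω
    rw [Finset.sum_eq_single_of_mem (s ω) (s.mem_range_self ω) fun x _ hx =>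
      Set.indicator_of_notMem (s := s ⁻¹' {x}) (fun h => hx (Eq.symm h)) fun ω => N ω x]
    exact (Set.indicator_of_mem (s := s ⁻¹' {s ω}) rfl fun ω' => N ω' (s ω)).symm
  rw [hsum]
  exact Finset.stronglyMeasurable_fun_sum _ fun x _ =>
    (hN x).stronglyMeasurable.indicator (s.measurableSet_fiber x)

/-- A strongly measurable function on a `σ`-finite measure space oscillates by at most `ε` on each
piece of a suitable countable partition into measurable sets of finite measure; the partition is
given by its index function. -/
theorem exists_countable_partition_norm_sub_le {Ω E : Type*} [MeasurableSpace Ω] (μ : Measure Ω)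
    [SigmaFinite μ] [NormedAddCommGroup E] {f : Ω → E} (hf : StronglyMeasurable f) {ε : ℝ}
    (hε : 0 < ε) :
    ∃ i : Ω → ℕ, Measurable i ∧ (∀ k, μ (i ⁻¹' {k}) ≠ ∞) ∧
      ∀ ω ω', i ω = i ω' → ‖f ω - f ω'‖ ≤ ε := by
  classical
  rcases isEmpty_or_nonempty Ω with hΩ | ⟨⟨ω₀⟩⟩
  · exact ⟨fun _ => 0, measurable_const, fun k => by simp [Set.eq_empty_of_isEmpty],
      fun ω => hΩ.elim ω⟩
  obtain ⟨S, hS, hfS⟩ := hf.isSeparable_range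
  have hne : S.Nonempty := closure_nonempty_iff.1 ⟨f ω₀, hfS ⟨ω₀, rfl⟩⟩
  obtain ⟨v, rfl⟩ := hS.exists_eq_range hne
  have hex : ∀ ω, ∃ k, dist (f ω) (v k) < ε / 2 := fun ω => by
    obtain ⟨_, ⟨k, rfl⟩, hk⟩ := Metric.mem_closure_iff.1 (hfS ⟨ω, rfl⟩) (ε / 2) (by positivity)
    exact ⟨k, hk⟩
  have hfind : Measurable fun ω => Nat.find (hex ω) := measurable_find hex fun k =>
    (hf.dist stronglyMeasurable_const).measurableSet_lt stronglyMeasurable_const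
  refine ⟨fun ω => Nat.pair (spanningSetsIndex μ ω) (Nat.find (hex ω)), ?_, fun k => ?_,
    fun ω ω' h => ?_⟩
  · exact (Measurable.of_discrete (f := fun p : ℕ × ℕ => Nat.pair p.1 p.2)).comp
      ((measurableSet_spanningSetsIndex μ).prodMk hfind)
  · refine ((measure_mono ?_).trans_lt (measure_spanningSets_lt_top μ k.unpair.1)).ne
    rintro ω rfl
    rw [Nat.unpair_pair]
    exact mem_spanningSetsIndex μ ω
  · have hk := (Nat.pair_eq_pair.1 h).2
    have h1 := Nat.find_spec (hex ω)
    have h2 := Nat.find_spec (hex ω')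
    rw [← hk] at h2
    rw [← dist_eq_norm]
    linarith [dist_triangle_right (f ω) (f ω') (v (Nat.find (hex ω)))]

end Measurability

section Sufficiency

variable {𝕜 : Type*} [RCLike 𝕜] {X : Type*} [NormedAddCommGroup X] [NormedSpace 𝕜 X]

/-- The case `m = 1` of `γ`-boundedness is a uniform bound on the operator norms. -/
theorem GammaBoundedWith.norm_apply_le {Y : Type*} [NormedAddCommGroup Y] [NormedSpace 𝕜 Y]
    {τ : Set (X →L[𝕜] Y)} {K : ℝ≥0} (hτ : GammaBoundedWith τ K) {T : X →L[𝕜] Y} (hT : T ∈ τ)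
    (x : X) : ‖T x‖ ≤ K * ‖x‖ := by
  have h := hτ 1 (fun _ => T) (fun _ => x) fun _ => hT
  rw [gaussSumNorm_single (T x), gaussSumNorm_single x, mul_left_comm] at h
  have h1 := (ENNReal.mul_le_mul_iff_right gaussSumNorm_one_ne_zero
    (gaussSumNorm_lt_top _).ne).1 h
  simp only [enorm_eq_nnnorm] at h1
  exact_mod_cast h1

variable {Ω : Type*} [MeasurableSpace Ω] {μ : Measure Ω} [CompleteSpace X]

/-- If `f` and `N f` both oscillate by at most `ε` on the pieces `{i = k}` of a countable partition,
then `N f` is almost everywhere `(K + 1) ε`-close to a countably valued function whose `γ`-norm is at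
most `K ‖f‖_γ`. On each piece this function applies the operator `N ω` at a sample point `ω` to the mean
value of `f`, and these mean values are the images under `u_f` of an orthogonal system. -/
theorem MemP2.exists_countablyValued_approx {N : Ω → X →L[𝕜] X} {K : ℝ≥0}
    (hN : GammaBoundedWith (Set.range N) K) {f : Ω → X} (hf : MemP2 𝕜 f μ)
    (hγ : gammaNorm hf.op ≠ ∞) {i : Ω → ℕ} (hi : Measurable i) (hfin : ∀ k, μ (i ⁻¹' {k}) ≠ ∞)
    {ε : ℝ} (hosc : ∀ ω ω', i ω = i ω' → ‖f ω - f ω'‖ ≤ ε)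
    (hosc' : ∀ ω ω', i ω = i ω' → ‖N ω (f ω) - N ω' (f ω')‖ ≤ ε) :
    ∃ (G : Ω → X) (hG : MemP2 𝕜 G μ), gammaNorm hG.op ≤ K * gammaNorm hf.op ∧
      ∀ᵐ ω ∂μ, ‖G ω - N ω (f ω)‖ ≤ (K + 1) * ε := by
  classical
  -- Null pieces carry no normalised indicator and are discarded.
  let J := {k : ℕ // μ (i ⁻¹' {k}) ≠ 0}
  let A : J → Set Ω := fun k => i ⁻¹' {k.1}
  have hA : ∀ k, MeasurableSet (A k) := fun k => hi (measurableSet_singleton _)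
  have hAfin : ∀ k, μ (A k) ≠ ∞ := fun k => hfin k
  have hAdis : Pairwise (Function.onFun Disjoint A) := fun k l hkl =>
    Disjoint.preimage _ (Set.disjoint_singleton.2 (Subtype.coe_injective.ne hkl))
  choose c hc0 hc using fun k : J => exists_sq_mul_measureReal_eq_one k.2 (hfin k)
  choose p hp using fun k : J => nonempty_of_measure_ne_zero k.2
  let a : J → X := fun k => hf.op (indicatorConstLp 2 (hA k) (hAfin k) (c k : 𝕜))
  let g : J → Ω → X := fun k => (A k).indicator fun _ => (c k : 𝕜) • N (p k) (a k)
  let I : ℕ → Finset J := fun M => (Finset.range M).subtype _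
  let G : Ω → X := fun ω => if h : μ (i ⁻¹' {i ω}) ≠ 0 then g ⟨i ω, h⟩ ω else 0
  have htrunc : ∀ M, ∃ hG : MemP2 𝕜 (fun ω => ∑ k ∈ I M, g k ω) μ,
      gammaNorm hG.op ≤ K * gammaNorm hf.op := by
    intro M
    let σ := (I M).equivFin.symm
    have hσ : Function.Injective fun j => (σ j : J) := Subtype.coe_injective.comp σ.injective
    have hdis : Pairwise (Function.onFun Disjoint fun j => A (σ j)) := fun j l hjl =>
      hAdis (hσ.ne hjl)
    obtain ⟨hG, hle, -⟩ := exists_gammaNorm_op_sum_indicator_le (𝕜 := 𝕜) (fun j => hA (σ j))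
      (fun j => hAfin (σ j)) hdis (fun j => hc (σ j)) (fun j => N (p (σ j)) (a (σ j)))
    have heq : (fun ω => ∑ j, g (σ j) ω) = fun ω => ∑ k ∈ I M, g k ω := by
      funext ω
      exact (Equiv.sum_comp σ fun k => g k ω).trans (Finset.sum_coe_sort (I M) fun k => g k ω)
    have hbound : gammaNorm hG.op ≤ K * gammaNorm hf.op :=
      hle.trans ((hN _ (fun j => N (p (σ j))) (fun j => a (σ j)) fun j => ⟨_, rfl⟩).trans
        (mul_le_mul_right (gaussSumNorm_le_gammaNorm hf.op (orthonormal_indicatorConstLp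
          (fun j => hA (σ j)) (fun j => hAfin (σ j)) hdis fun j => hc (σ j))) _))
    rw [← heq]
    exact ⟨hG, hbound⟩
  have hpos : ∀ᵐ ω ∂μ, μ (i ⁻¹' {i ω}) ≠ 0 := by
    have : ∀ᵐ ω ∂μ, ∀ k, i ω = k → μ (i ⁻¹' {k}) ≠ 0 := by
      refine ae_all_iff.2 fun k => ?_
      by_cases hk : μ (i ⁻¹' {k}) = 0
      · filter_upwards [measure_eq_zero_iff_ae_notMem.1 hk] with ω hω h
        exact (hω h).elim
      · exact Eventually.of_forall fun _ _ => hk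
    filter_upwards [this] with ω hω
    exact hω _ rfl
  choose hGM hGMle using htrunc
  obtain ⟨hG, hGle⟩ := MemP2.of_tendsto_ae (g := G) (by finiteness) hGM hGMle (by
    filter_upwards [hpos] with ω hω
    refine tendsto_const_nhds.congr' ?_
    filter_upwards [eventually_gt_atTop (i ω)] with M hM
    have hGω : G ω = g ⟨i ω, hω⟩ ω := dif_pos hω
    rw [hGω]
    refine (Finset.sum_eq_single_of_mem (s := I M) (f := fun k => g k ω) (⟨i ω, hω⟩ : J)
      (Finset.mem_subtype.2 (Finset.mem_range.2 hM)) fun k _ hk => ?_).symm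
    exact Set.indicator_of_notMem (s := A k) (fun h => hk (Subtype.ext (Eq.symm h)))
      fun _ => (c k : 𝕜) • N (p k) (a k))
  refine ⟨G, hG, hGle, ?_⟩
  filter_upwards [hpos] with ω hω
  set k : J := ⟨i ω, hω⟩ with hk
  have hGω : G ω = N (p k) ((c k : 𝕜) • a k) := by
    rw [map_smul]
    exact (dif_pos hω).trans (Set.indicator_of_mem (s := A k) rfl _)
  have hcpos : 0 < c k := lt_of_le_of_ne (hc0 k) fun h => by
    have := hc k
    rw [← h] at this
    simp at this
  have hcK : (c k : 𝕜) ≠ 0 := RCLike.ofReal_ne_zero.2 hcpos.ne'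
  have hmean : ‖(c k : 𝕜) • a k - f (p k)‖ ≤ ε := by
    have h1 := hf.norm_op_indicatorConstLp_sub_le (hA k) (hAfin k) (hc0 k) (hc k)
      (y := (c k : 𝕜)⁻¹ • f (p k)) (ε := ε / c k) fun ω' hω' => by
        rw [smul_inv_smul₀ hcK, mul_div_cancel₀ _ hcpos.ne']
        exact hosc _ _ ((show i ω' = _ from hω').trans (Eq.symm (hp k)))
    have h2 : (c k : 𝕜) • a k - f (p k) = (c k : 𝕜) • (a k - (c k : 𝕜)⁻¹ • f (p k)) := by
      rw [smul_sub, smul_inv_smul₀ hcK]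
    rw [h2, norm_smul, RCLike.norm_ofReal, abs_of_pos hcpos]
    exact (mul_le_mul_of_nonneg_left h1 hcpos.le).trans_eq (mul_div_cancel₀ _ hcpos.ne')
  have h3 : G ω - N ω (f ω) =
      N (p k) ((c k : 𝕜) • a k - f (p k)) + (N (p k) (f (p k)) - N ω (f ω)) := by
    rw [hGω, map_sub]
    abel
  rw [h3]
  calc _ ≤ ‖N (p k) ((c k : 𝕜) • a k - f (p k))‖ + ‖N (p k) (f (p k)) - N ω (f ω)‖ :=
        norm_add_le _ _
    _ ≤ K * ε + ε := add_le_add ((hN.norm_apply_le ⟨_, rfl⟩ _).trans (by gcongr))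
        (hosc' _ _ (hp k))
    _ = _ := by ring

/-- A `γ`-bounded family acts boundedly by multiplication on `γ₊(Ω, X)`, as soon as `N f` is
measurable. -/
theorem MemP2.exists_gammaNorm_op_apply_le [SigmaFinite μ] {N : Ω → X →L[𝕜] X} {K : ℝ≥0}
    (hN : GammaBoundedWith (Set.range N) K) {f : Ω → X} (hf : MemP2 𝕜 f μ)
    (hγ : gammaNorm hf.op ≠ ∞) (hfm : StronglyMeasurable f)
    (hNfm : StronglyMeasurable fun ω => N ω (f ω)) :
    ∃ hNf : MemP2 𝕜 (fun ω => N ω (f ω)) μ, gammaNorm hNf.op ≤ K * gammaNorm hf.op := by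
  have happrox : ∀ n : ℕ, ∃ (G : Ω → X) (hG : MemP2 𝕜 G μ),
      gammaNorm hG.op ≤ K * gammaNorm hf.op ∧
        ∀ᵐ ω ∂μ, ‖G ω - N ω (f ω)‖ ≤ (K + 1) * (1 / ((n : ℝ) + 1)) := by
    intro n
    obtain ⟨i, hi, hfin, hosc⟩ := exists_countable_partition_norm_sub_le μ (hfm.prodMk hNfm)
      (ε := 1 / ((n : ℝ) + 1)) (by positivity)
    exact hf.exists_countablyValued_approx hN hγ hi hfin
      (fun ω ω' h => (norm_fst_le _).trans (hosc ω ω' h))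
      (fun ω ω' h => (norm_snd_le _).trans (hosc ω ω' h))
  choose G hG hGle hGclose using happrox
  refine MemP2.of_tendsto_ae (by finiteness) hG hGle ?_
  filter_upwards [ae_all_iff.2 hGclose] with ω hω
  rw [tendsto_iff_norm_sub_tendsto_zero]
  refine squeeze_zero (fun _ => norm_nonneg _) hω ?_
  simpa using tendsto_one_div_add_atTop_nhds_zero_nat.const_mul ((K : ℝ) + 1)

end Sufficiency

/-! ### The multiplier characterisation -/

theorem proposition4p11 {𝕜 : Type*} [RCLike 𝕜]
    {X : Type*} [NormedAddCommGroup X] [NormedSpace 𝕜 X] [CompleteSpace X]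
    {Ω : Type*} [MetricSpace Ω] [LocallyCompactSpace Ω] [PerfectSpace Ω]
    [MeasurableSpace Ω] [BorelSpace Ω] (μ : Measure Ω) [SigmaFinite μ] [μ.IsOpenPosMeasure]
    (N : Ω → X →L[𝕜] X) (hN : ∀ x : X, Continuous fun ω => N ω x) (K : ℝ≥0) :
    GammaBoundedWith (Set.range N) K ↔
      ∀ f : Ω → X, MemGammaFun 𝕜 f μ →
        MemGammaPlusFun 𝕜 (fun ω => N ω (f ω)) μ ∧
          squareNorm 𝕜 (fun ω => N ω (f ω)) μ ≤ K * squareNorm 𝕜 f μ := by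
  refine ⟨fun hγ f hf => ?_, gammaBoundedWith_range_of_squareNorm_le hN⟩
  obtain ⟨hf, hfγ, -⟩ := hf
  have := secondCountableTopology_of_isOpenPosMeasure μ
  have hmk := hf.1.ae_eq_mk
  have hf' : MemP2 𝕜 (hf.1.mk f) μ := hf.congr hmk
  have hm : StronglyMeasurable (hf.1.mk f) := hf.1.stronglyMeasurable_mk
  have hop : hf'.op = hf.op := hf'.op_congr hf hmk.symm
  obtain ⟨hNf', hle⟩ := hf'.exists_gammaNorm_op_apply_le hγ (hop ▸ ne_of_lt hfγ) hm
    (stronglyMeasurable_clm_apply hN hm)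
  have hae : (fun ω => N ω (hf.1.mk f ω)) =ᵐ[μ] fun ω => N ω (f ω) := by
    filter_upwards [hmk] with ω hω
    rw [hω]
  have hNf := hNf'.congr hae
  rw [hop, hNf'.op_congr hNf hae] at hle
  refine ⟨⟨hNf, hle.trans_lt (ENNReal.mul_lt_top ENNReal.coe_lt_top hfγ)⟩, ?_⟩
  rw [squareNorm, squareNorm, dif_pos hf, dif_pos hNf]
  exact hle

end
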